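/- **Setting.** Let $m\ge 1$, $\Omega=\prod_{i=1}^m(l_i,r_i)$ with $l_i<r_i$, and $\alpha_1,\dots,\alpha_m\in(1,2)$. Let $d_i:\Omega\to\mathbb R$ satisfy $0<\check d_i\le d_i(x)\le\hat d_i$ on $\Omega$ for constants $\check d_i,\hat d_i$, put $\bar d_i=\sqrt{\hat d_i\check d_i}$, and assume that $d_i$ is Lipschitz in $x_i$, uniformly in the other variables: $$|d_i|_{\mathcal L_i(\Omega)}=\sup\Big\{\tfrac{|d_i(y)-d_i(z)|}{|y-z|}:\ y\ne z \text{ in }\Omega,\ y_j=z_j\ (j\neq i)\Big\}<\infty .$$ **Weights.** For each $i$ let $\{s_k^{(\alpha_i)}\}_{k\ge0}$ be given by one of the following three schemes for the Riesz derivative of order $\gamma=\alpha_i$. (a) Fractional centred differences: $s_0=\Gamma(\gamma+1)/\Gamma(\gamma/2+1)^2$ and $s_{k+1}=\big(1-\frac{\gamma+1}{\gamma/2+k+1}\big)s_k$. (b) Shifted Grünwald: $s_k=\frac{-1}{2\cos(\gamma\pi/2)}w_k$ with $w_0=2g_1$, $w_1=g_0+g_2$, $w_k=g_{k+1}$ $(k\ge2)$,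 where $g_0=-1$ and $g_{k+1}=(1-\frac{\gamma+1}{k+1})g_k$. (c) Second-order weighted scheme: $s_k=\frac{-1}{2\cos(\gamma\pi/2)\Gamma(4-\gamma)}w_k$ with $w_0=2p_1$, $w_1=p_0+p_2$, $w_k=p_{k+1}$ $(k\ge2)$, where $p_0=-1$, $p_1=4-2^{3-\gamma}$, $p_2=-3^{3-\gamma}+4\cdot2^{3-\gamma}-6$, and $p_k=-(k+1)^{3-\gamma}+4k^{3-\gamma}-6(k-1)^{3-\gamma}+4(k-2)^{3-\gamma}-(k-3)^{3-\gamma}$ for $k\ge3$. More generally, $\{s_k\}$ may be any real sequence with: $\|\{s_k\}\|_{\mathcal D_\gamma}:=\sup_{k\ge 0}|s_k|(1+k)^{1+\gamma}<\infty$; $s_0>0$ and $s_k\le 0$ for $k\ge1$; $\inf_{n\ge1}(n+1)^\gamma\big(s_0+2\sum_{k=1}^{n-1}s_k\big)>0$; $s_k\le s_{k+1}$ for $k\ge1$. **Matrices.** For positive integers $M_1,\dots,M_m$ and $\Delta t>0$ put $h_i=(r_i-l_i)/(M_i+1)$ and $\eta_i=\Delta t/h_i^{\alpha_i}$. Let $S_{\alpha_i}$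 be the $M_i\times M_i$ symmetric Toeplitz matrix with first column $(s^{(\alpha_i)}_0,\dots,s^{(\alpha_i)}_{M_i-1})^{\rm T}$. For a symmetric Toeplitz matrix $T$ of order $n$ with first column $(t_0,\dots,t_{n-1})^{\rm T}$ let $\tau(T)=T-H$, where $H$ is the Hankel matrix with first column $(t_2,\dots,t_{n-1},0,0)^{\rm T}$ and last column $(0,0,t_{n-1},\dots,t_2)^{\rm T}$ ($H=0$ if $n\le 2$). With $D_i$ the diagonal matrix of the values of $d_i$ at the interior points of the uniform grid with steps $h_i$, and with $S_{\alpha_i}$, $\tau(S_{\alpha_i})$ acting in the $i$-th direction, let $$A=I+\sum_{i=1}^m\eta_iD_i(I\otimes S_{\alpha_i}\otimes I),\qquad P=I+\sum_{i=1}^m\eta_i\bar d_i\,I\otimes\tau(S_{\alpha_i})\otimes I .$$ **Constants.** Let $$c_1=\min_i\sqrt{\tfrac{\check d_i}{2\hat d_i}},\quad c_2=\max_i\sqrt{\tfrac{2\hat d_i}{\check d_i}},\quad c_3=\max_i\frac{\hat d_i^2+\check d_i^2+1}{2\bar d_i},$$ and, with $q_i=\|\{s_k^{(\alpha_i)}\}\|_{\mathcal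 D_{\alpha_i}}\,|d_i|_{\mathcal L_i(\Omega)}^2\,(r_i-l_i)^{2-\alpha_i}/(2-\alpha_i)$, $$b_1=\sum_i\frac{q_i}{4(1-\sqrt2/2)\check d_i},\qquad b_2=\sum_i\frac{q_i}{4(\sqrt2-1)\hat d_i},\qquad b_3=\sum_i\frac{\hat d_i^2\,q_i}{\check d_i^2},$$ $$c_*=\min\Big\{\frac{1-c_1}{b_1},\frac{c_2-1}{b_2},\frac{c_3}{b_3}\Big\}\in(0,\infty]\quad(\text{a quotient with denominator }0\text{ is }+\infty),\qquad \theta=\sqrt{1-\frac{c_1^2}{3c_1c_2+9c_3^2}} .$$ None of these depends on $\Delta t$ or on the $M_i$. **Theorem.** One has $c_1\in(0,1)$, $c_2\ge\sqrt2$, $c_*>0$ and $\theta\in(0,1)$. For all $M_1,\dots,M_m\ge1$ and all $0<\Delta t\le c_*$ the matrix $P$ is symmetric positive definite, and for every right-hand side $b$ and every initial guess $u_0$ the (unrestarted) GMRES iterates $u_k$, $k\ge1$, for $P^{-1}Au=P^{-1}b$ (the minimisers of $\|P^{-1}b-P^{-1}Au\|_2$ over $u_0+\mathrm{span}\{(P^{-1}A)^jr_0:0\le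 j<k\}$, $r_0=P^{-1}b-P^{-1}Au_0$) exist, are unique, and satisfy $$\|r_k\|_2\le\theta^k\|\hat r_0\|_2,\qquad k\ge1,$$ where $r_k=P^{-1}b-P^{-1}Au_k$ and $\hat r_0=P^{-1/2}b-P^{-1/2}Au_0$. -/

import Mathlib

open scoped ENNReal

noncomputable section

namespace RieszGMRES

/-! ### Discretisation weights for the one-dimensional Riesz derivative of order `γ` -/

/-- Weights of the fractional centred difference scheme. -/
def centredWeight (γ : ℝ) : ℕ → ℝ
  | 0 => Real.Gamma (γ + 1) / Real.Gamma (γ / 2 + 1) ^ 2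
  | k + 1 => (1 - (γ + 1) / (γ / 2 + k + 1)) * centredWeight γ k

/-- Auxiliary Grünwald coefficients, with the sign normalisation `g₀ = -1`. -/
def grunwaldCoeff (γ : ℝ) : ℕ → ℝ
  | 0 => -1
  | k + 1 => (1 - (γ + 1) / (k + 1)) * grunwaldCoeff γ k

/-- Weights of the shifted Grünwald scheme. -/
def grunwaldWeight (γ : ℝ) (k : ℕ) : ℝ :=
  (-1 / (2 * Real.cos (γ * Real.pi / 2))) *
    (if k = 0 then 2 * grunwaldCoeff γ 1
     else if k = 1 then grunwaldCoeff γ 0 + grunwaldCoeff γ 2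
     else grunwaldCoeff γ (k + 1))

/-- Auxiliary coefficients of the second-order weighted scheme. All bases of the real powers are
nonnegative, and `0 ^ (3 - γ) = 0` for `γ < 3`. -/
def splineCoeff (γ : ℝ) (k : ℕ) : ℝ :=
  if k = 0 then -1
  else if k = 1 then 4 - (2 : ℝ) ^ (3 - γ)
  else if k = 2 then -(3 : ℝ) ^ (3 - γ) + 4 * (2 : ℝ) ^ (3 - γ) - 6
  else -((k : ℝ) + 1) ^ (3 - γ) + 4 * (k : ℝ) ^ (3 - γ) - 6 * ((k : ℝ) - 1) ^ (3 - γ)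
    + 4 * ((k : ℝ) - 2) ^ (3 - γ) - ((k : ℝ) - 3) ^ (3 - γ)

/-- Weights of the second-order weighted scheme. -/
def splineWeight (γ : ℝ) (k : ℕ) : ℝ :=
  (-1 / (2 * Real.cos (γ * Real.pi / 2) * Real.Gamma (4 - γ))) *
    (if k = 0 then 2 * splineCoeff γ 1
     else if k = 1 then splineCoeff γ 0 + splineCoeff γ 2
     else splineCoeff γ (k + 1))

/-- The values `|w_k| (1 + k)^(1 + s)`, `k ≥ 0`. -/
def decayValues (s : ℝ) (w : ℕ → ℝ) : Set ℝ :=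
  Set.range fun k : ℕ => |w k| * (1 + (k : ℝ)) ^ (1 + s)

/-- `‖{w_k}‖_{𝒟_s} = sup_{k ≥ 0} |w_k| (1 + k)^(1 + s)`. -/
def decayNorm (s : ℝ) (w : ℕ → ℝ) : ℝ := sSup (decayValues s w)

/-- The four structural properties of a weight sequence of order `γ`. -/
structure HasWeightProperties (γ : ℝ) (w : ℕ → ℝ) : Prop where
  decay : BddAbove (decayValues γ w)
  zero_pos : 0 < w 0
  nonpos : ∀ k, 1 ≤ k → w k ≤ 0
  lower : ∃ ε : ℝ, 0 < ε ∧ ∀ n : ℕ, 1 ≤ n →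
    ε ≤ ((n : ℝ) + 1) ^ γ * (w 0 + 2 * ∑ k ∈ Finset.Ico 1 n, w k)
  mono : ∀ k, 1 ≤ k → w k ≤ w (k + 1)

/-- Admissible weights: those of one of the three concrete schemes and, more generally, every
sequence with the four structural properties. -/
inductive IsRieszWeight (γ : ℝ) : (ℕ → ℝ) → Prop
  | centred : IsRieszWeight γ (centredWeight γ)
  | grunwald : IsRieszWeight γ (grunwaldWeight γ)
  | spline : IsRieszWeight γ (splineWeight γ)
  | general (w : ℕ → ℝ) (hw : HasWeightProperties γ w) : IsRieszWeight γ w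

/-! ### Toeplitz matrices, `τ`-matrices, Kronecker products, matrix powers -/

/-- The symmetric Toeplitz matrix with first column `t 0, …, t (n - 1)`. -/
def toeplitz (t : ℕ → ℝ) (n : ℕ) : Matrix (Fin n) (Fin n) ℝ :=
  Matrix.of fun i j => t ((i : ℤ) - (j : ℤ)).natAbs

/-- The Hankel matrix with first column `t 2, …, t (n - 1), 0, 0` and last column
`0, 0, t (n - 1), …, t 2`. In one-based indices its entry depends only on `p = i + j`: it is
`t p` for `p ≤ n - 1`, it is `t (2 n + 2 - p)` for `p ≥ n + 3`, and `0` in between. -/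
def hankelPart (t : ℕ → ℝ) (n : ℕ) : Matrix (Fin n) (Fin n) ℝ :=
  Matrix.of fun i j =>
    let p : ℕ := ((i : ℕ) + 1) + ((j : ℕ) + 1)
    if p + 1 ≤ n then t p else if n + 3 ≤ p then t (2 * n + 2 - p) else 0

/-- The `τ`-matrix approximation of the symmetric Toeplitz matrix generated by `t`. -/
def tauMatrix (t : ℕ → ℝ) (n : ℕ) : Matrix (Fin n) (Fin n) ℝ :=
  toeplitz t n - hankelPart t n

/-- Multi-indices of interior grid points (zero-based). -/
abbrev MIdx {m : ℕ} (M : Fin m → ℕ) : Type := (i : Fin m) → Fin (M i)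

/-- The Kronecker product `I ⊗ B ⊗ I` with `B` in position `i`, with rows and columns indexed by
multi-indices instead of their lexicographic positions. -/
def modeKron {m : ℕ} {M : Fin m → ℕ} (i : Fin m) (B : Matrix (Fin (M i)) (Fin (M i)) ℝ) :
    Matrix (MIdx M) (MIdx M) ℝ :=
  Matrix.of fun K K' => if ∀ j, j ≠ i → K j = K' j then B (K i) (K' i) else 0

/-- The real power `B ^ z` of a positive definite matrix: apply `x ↦ x ^ z` to the eigenvalues in
an orthogonal diagonalisation of `B`. -/
def matPow {ι : Type} [Fintype ι] [DecidableEq ι] (B : Matrix ι ι ℝ) (z : ℝ) : Matrix ι ι ℝ :=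
  cfc (fun x : ℝ => x ^ z) B

/-- The Euclidean norm of a vector. -/
def norm₂ {ι : Type} [Fintype ι] (v : ι → ℝ) : ℝ := √(∑ K, v K ^ 2)

/-! ### GMRES -/

/-- The Krylov space `𝒦_k(Z, x) = span {x, Z x, …, Z^(k-1) x}`. -/
def krylov {ι : Type} [Fintype ι] [DecidableEq ι] (Z : Matrix ι ι ℝ) (x : ι → ℝ) (k : ℕ) :
    Submodule ℝ (ι → ℝ) :=
  Submodule.span ℝ {y | ∃ j : ℕ, j < k ∧ y = Matrix.mulVec (Z ^ j) x}

/-- `u` is the `k`-th (full, unrestarted) GMRES iterate for `Z v = w` with initial guess `u₀`: it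
minimises the Euclidean norm of the residual over `u₀ + 𝒦_k(Z, w - Z u₀)`. -/
def IsGMRESIterate {ι : Type} [Fintype ι] [DecidableEq ι] (Z : Matrix ι ι ℝ) (w u₀ : ι → ℝ)
    (k : ℕ) (u : ι → ℝ) : Prop :=
  u - u₀ ∈ krylov Z (w - Matrix.mulVec Z u₀) k ∧
    ∀ v : ι → ℝ, v - u₀ ∈ krylov Z (w - Matrix.mulVec Z u₀) k →
      norm₂ (w - Matrix.mulVec Z u) ≤ norm₂ (w - Matrix.mulVec Z v)

/-! ### The `m`-dimensional problem -/

/-- The data of the `m`-dimensional variable-coefficient Riesz space-fractional diffusion problem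
and of its discretisation, apart from the step sizes. -/
structure Data (m : ℕ) where
  /-- left end points of the box -/
  l : Fin m → ℝ
  /-- right end points of the box -/
  r : Fin m → ℝ
  /-- fractional orders -/
  α : Fin m → ℝ
  /-- `s i` is the weight sequence used for the derivative of order `α i` in direction `i` -/
  s : Fin m → ℕ → ℝ
  /-- diffusion coefficients -/
  d : Fin m → (Fin m → ℝ) → ℝ
  /-- lower bounds of the coefficients -/
  dlo : Fin m → ℝ
  /-- upper bounds of the coefficients -/
  dhi : Fin m → ℝ

namespace Data

variable {m : ℕ} (D : Data m)

/-- The open box `Ω = ∏ (l_i, r_i)`. -/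
def Ω : Set (Fin m → ℝ) := {x | ∀ i, x i ∈ Set.Ioo (D.l i) (D.r i)}

/-- The segment through `x` in direction `i`. -/
def segment (i : Fin m) (x : Fin m → ℝ) : Set (Fin m → ℝ) :=
  {y | y i ∈ Set.Ioo (D.l i) (D.r i) ∧ ∀ j, j ≠ i → y j = x j}

/-- The difference quotients of `w` in direction `i` on `Ω`. -/
def lipQuotients (i : Fin m) (w : (Fin m → ℝ) → ℝ) : Set ℝ :=
  {q | ∃ x ∈ D.Ω, ∃ y ∈ D.segment i x, ∃ z ∈ D.segment i x, y ≠ z ∧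
    q = |w y - w z| / √(∑ k, |y k - z k| ^ 2)}

/-- `w ∈ ℒ_i(Ω)`: `w` is Lipschitz in the variable `x_i`, uniformly in the other variables. -/
def MemLip (i : Fin m) (w : (Fin m → ℝ) → ℝ) : Prop := BddAbove (D.lipQuotients i w)

/-- The seminorm `|w|_{ℒ_i(Ω)}`. -/
def lipSeminorm (i : Fin m) (w : (Fin m → ℝ) → ℝ) : ℝ := sSup (D.lipQuotients i w)

/-- `d̄_i = √(d̂_i ď_i)`. -/
def dbar (i : Fin m) : ℝ := √(D.dhi i * D.dlo i)

/-- Spatial step sizes `h_i = (r_i - l_i) / (M_i + 1)`. -/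
def h (M : Fin m → ℕ) (i : Fin m) : ℝ := (D.r i - D.l i) / ((M i : ℝ) + 1)

/-- Interior grid points; the one-based index in direction `i` is `K i + 1`. -/
def gridPoint (M : Fin m → ℕ) (K : MIdx M) : Fin m → ℝ :=
  fun i => D.l i + (((K i : ℕ) : ℝ) + 1) * D.h M i

/-- `η_i = Δt / h_i ^ α_i`. -/
def η (M : Fin m → ℕ) (Δt : ℝ) (i : Fin m) : ℝ := Δt / D.h M i ^ D.α i

/-- The coefficient matrix `A = I + ∑ η_i D_i (I ⊗ S_{α_i, M_i} ⊗ I)`. -/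
def A (M : Fin m → ℕ) (Δt : ℝ) : Matrix (MIdx M) (MIdx M) ℝ :=
  1 + ∑ i, D.η M Δt i •
    (Matrix.diagonal (fun K => D.d i (D.gridPoint M K)) * modeKron i (toeplitz (D.s i) (M i)))

/-- The `τ`-preconditioner `P = I + ∑ η_i d̄_i (I ⊗ τ(S_{α_i, M_i}) ⊗ I)`. -/
def P (M : Fin m → ℕ) (Δt : ℝ) : Matrix (MIdx M) (MIdx M) ℝ :=
  1 + ∑ i, D.η M Δt i • (D.dbar i • modeKron i (tauMatrix (D.s i) (M i)))

def c₁ : ℝ := ⨅ i, √(D.dlo i / (2 * D.dhi i))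

def c₂ : ℝ := ⨆ i, √(2 * D.dhi i / D.dlo i)

def c₃ : ℝ := ⨆ i, (D.dhi i ^ 2 + D.dlo i ^ 2 + 1) / (2 * D.dbar i)

def b₁ : ℝ := ∑ i, decayNorm (D.α i) (D.s i) * D.lipSeminorm i (D.d i) ^ 2 *
  (D.r i - D.l i) ^ (2 - D.α i) / (4 * (1 - √2 / 2) * D.dlo i * (2 - D.α i))

def b₂ : ℝ := ∑ i, decayNorm (D.α i) (D.s i) * D.lipSeminorm i (D.d i) ^ 2 *
  (D.r i - D.l i) ^ (2 - D.α i) / (4 * (√2 - 1) * D.dhi i * (2 - D.α i))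

def b₃ : ℝ := ∑ i, decayNorm (D.α i) (D.s i) * D.dhi i ^ 2 * D.lipSeminorm i (D.d i) ^ 2 *
  (D.r i - D.l i) ^ (2 - D.α i) / (D.dlo i ^ 2 * (2 - D.α i))

/-- The bound on the time step. It takes values in `[0, ∞]`, so that a quotient whose
denominator vanishes (coefficients that are constant in the Lipschitz directions) imposes no
restriction. -/
def cStar : ℝ≥0∞ :=
  min (ENNReal.ofReal (1 - D.c₁) / ENNReal.ofReal D.b₁)
    (min (ENNReal.ofReal (D.c₂ - 1) / ENNReal.ofReal D.b₂)
      (ENNReal.ofReal D.c₃ / ENNReal.ofReal D.b₃))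

/-- The convergence factor. -/
def θ : ℝ := √(1 - D.c₁ ^ 2 / (3 * D.c₁ * D.c₂ + 9 * D.c₃ ^ 2))

end Data

end RieszGMRES

end

/-! Everything reduces to three bounds on quadratic forms: `a P ≤ sym A ≤ c P`, and the skew part of
`A` bounded by `e P`, with `a = c₁/2`, `c = 3c₂/2`, `e = 3c₃/2`. Under these, Richardson iteration
for `P⁻¹A` with step `(c + e²/a)⁻¹` multiplies the squared `P`-norm of the residual by at most `1 -
a²/(ac + e²) = θ²` per step (`richardson_step`). Its iterates lie in the Krylov spaces, so the GMRES
residual is no larger in the Euclidean norm. Since `P ≥ I`, that norm is dominated by the `P`-norm,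
and the `P`-norm of the initial residual is the Euclidean norm of `P^(-1/2)(b - A u₀)`
(`gmres_residual_le`).

The form bounds come from two independent comparisons. First, with `S` the Toeplitz matrix and `H`
its Hankel correction, `S + H` and `S - 3H` are weakly diagonally dominant, which gives `τ(S)/2 ≤ S
≤ (3/2) τ(S)` (`IsAdmissible.tauMatrix_equiv`). Secondly, the variable coefficient in `D S` can be
replaced by a constant. The form is a sum over pairs of grid points, and Young's inequality leaves
an error governed by `∑ |S_jk| (d_j - d_k)²`. The Lipschitz bound on `d` and the decay of the
weights make this error, multiplied by `η`, at most a multiple of `Δt` independent of the mesh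
(`sum_abs_modeKron_mul_sq_le`). For `Δt ≤ c_*` the identity in `A` absorbs it.

The analysis needs only signs, monotonicity, decay and nonnegative row sums of the weights. For the
concrete schemes these follow from recurrences, or from mean values of finite differences of `t ^ (3
- γ)`. -/

/-! ### Finite differences of real powers -/

theorem continuousOn_fwdDiff_iter {f : ℝ → ℝ} {x : ℝ} (hf : ContinuousOn f (Set.Ici x)) (n : ℕ) :
    ContinuousOn ((fwdDiff (1 : ℝ))^[n] f) (Set.Ici x) := by
  induction n with
  | zero => simpa using hf
  | succ n ih =>
    rw [Function.iterate_succ_apply']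
    refine ContinuousOn.sub (ih.comp (by fun_prop) ?_) ih
    intro y hy
    simp only [Set.mem_Ici] at hy ⊢
    linarith

theorem hasDerivAt_fwdDiff_iter {f f' : ℝ → ℝ} (hf : ∀ x, 0 < x → HasDerivAt f (f' x) x)
    (n : ℕ) : ∀ x, 0 < x → HasDerivAt ((fwdDiff (1 : ℝ))^[n] f) ((fwdDiff (1 : ℝ))^[n] f' x) x := by
  induction n with
  | zero => simpa using hf
  | succ n ih =>
    intro x hx
    rw [Function.iterate_succ_apply', Function.iterate_succ_apply']
    exact ((ih (x + 1) (by linarith)).comp_add_const x 1).sub (ih x hx)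

/-- The mean value theorem applied to the `n`-th difference, which commutes with differentiation.
Only continuity is needed at the left end point, so `x = 0` is allowed when `a > 0`. -/
theorem exists_fwdDiff_iter_succ_rpow (a x : ℝ) (hx : 0 ≤ x) (h : 0 < x ∨ 0 < a) (n : ℕ) :
    ∃ ξ, x < ξ ∧ ξ < x + 1 ∧
      (fwdDiff (1 : ℝ))^[n + 1] (fun t : ℝ => t ^ a) x
        = a * (fwdDiff (1 : ℝ))^[n] (fun t : ℝ => t ^ (a - 1)) ξ := by
  have hcont : ContinuousOn (fun t : ℝ => t ^ a) (Set.Ici x) := by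
    refine ContinuousOn.rpow_const continuousOn_id fun t ht => ?_
    rcases h with h | h
    · exact Or.inl (lt_of_lt_of_le h ht).ne'
    · exact Or.inr h.le
  have hder : ∀ t : ℝ, 0 < t → HasDerivAt (fun t : ℝ => t ^ a)
      ((a • fun t : ℝ => t ^ (a - 1)) t) t := fun t ht => by
    simpa using Real.hasDerivAt_rpow_const (p := a) (Or.inl ht.ne')
  obtain ⟨ξ, hξ, h2⟩ := exists_hasDerivAt_eq_slope ((fwdDiff (1 : ℝ))^[n] (fun t : ℝ => t ^ a))
    ((fwdDiff (1 : ℝ))^[n] (a • fun t : ℝ => t ^ (a - 1))) (lt_add_one x)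
    ((continuousOn_fwdDiff_iter hcont n).mono Set.Icc_subset_Ici_self)
    (fun y hy => hasDerivAt_fwdDiff_iter hder n y (lt_of_le_of_lt hx hy.1))
  refine ⟨ξ, hξ.1, hξ.2, ?_⟩
  rw [Function.iterate_succ_apply', fwdDiff]
  rw [fwdDiff_iter_const_smul] at h2
  simp at h2
  exact h2.symm

theorem exists_fwdDiff_iter_rpow_of_pos (n : ℕ) : ∀ a x : ℝ, 0 < x →
    ∃ ξ, x ≤ ξ ∧ ξ ≤ x + n ∧
      (fwdDiff (1 : ℝ))^[n] (fun t : ℝ => t ^ a) x = (∏ i ∈ Finset.range n, (a - i)) * ξ ^ (a - n) := by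
  induction n with
  | zero => intro a x hx; exact ⟨x, le_rfl, by simp, by simp⟩
  | succ n ih =>
    intro a x hx
    obtain ⟨ξ, h1, h2, h3⟩ := exists_fwdDiff_iter_succ_rpow a x hx.le (Or.inl hx) n
    obtain ⟨ζ, h4, h5, h6⟩ := ih (a - 1) ξ (hx.trans h1)
    refine ⟨ζ, by linarith, by push_cast; linarith, ?_⟩
    rw [h3, h6, Finset.prod_range_succ']
    push_cast
    rw [show a - ((n : ℝ) + 1) = a - 1 - n by ring,
      Finset.prod_congr rfl (g := fun i : ℕ => a - ((i : ℝ) + 1)) (fun i _ => by ring)]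
    ring

/-- The first mean value step moves the base point strictly away from `0`. After it the exponents
may become negative without harm. -/
theorem exists_fwdDiff_iter_rpow {n : ℕ} (hn : n ≠ 0) {a x : ℝ} (hx : 0 ≤ x) (ha : 0 < a) :
    ∃ ξ, 0 < ξ ∧ x ≤ ξ ∧
      (fwdDiff (1 : ℝ))^[n] (fun t : ℝ => t ^ a) x = (∏ i ∈ Finset.range n, (a - i)) * ξ ^ (a - n) := by
  obtain ⟨n, rfl⟩ := Nat.exists_eq_succ_of_ne_zero hn
  obtain ⟨ξ, h1, h2, h3⟩ := exists_fwdDiff_iter_succ_rpow a x hx (Or.inr ha) n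
  obtain ⟨ζ, h4, h5, h6⟩ := exists_fwdDiff_iter_rpow_of_pos n (a - 1) ξ (hx.trans_lt h1)
  refine ⟨ζ, by linarith, by linarith, ?_⟩
  rw [Nat.succ_eq_add_one, h3, h6, Finset.prod_range_succ']
  push_cast
  rw [show a - ((n : ℝ) + 1) = a - 1 - n by ring,
    Finset.prod_congr rfl (g := fun i : ℕ => a - ((i : ℝ) + 1)) (fun i _ => by ring)]
  ring

/-- Comparison with the integral of `t ^ (1 - γ)`, done term by term: the increment of `t ^ (2 - γ)`
over `[n, n + 1]` is `(2 - γ) ξ ^ (1 - γ)`, and `t ^ (1 - γ)` decreases. -/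
theorem sum_rpow_le {γ : ℝ} (h1 : 1 < γ) (h2 : γ < 2) (n : ℕ) :
    ∑ t ∈ Finset.range n, ((t : ℝ) + 1) ^ (1 - γ) ≤ (n : ℝ) ^ (2 - γ) / (2 - γ) := by
  have hp : 0 < 2 - γ := by linarith
  rw [le_div_iff₀ hp]
  induction n with
  | zero => simp [hp.ne']
  | succ n ih =>
    obtain ⟨ξ, h3, h4, h5⟩ := exists_fwdDiff_iter_succ_rpow (2 - γ) n (by positivity)
      (Or.inr hp) 0
    simp only [zero_add, Function.iterate_one, Function.iterate_zero, id, fwdDiff] at h5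
    have h6 : ((n : ℝ) + 1) ^ (1 - γ) ≤ ξ ^ (1 - γ) :=
      Real.rpow_le_rpow_of_nonpos (lt_of_le_of_lt (by positivity) h3) h4.le (by linarith)
    rw [show 2 - γ - 1 = 1 - γ by ring] at h5
    rw [Finset.sum_range_succ]
    push_cast
    nlinarith

/-! ### Admissibility of the weight schemes -/

namespace RieszGMRES

/-- The part of the structural properties of a weight sequence that the convergence analysis
uses. -/
structure IsAdmissible (γ : ℝ) (w : ℕ → ℝ) : Prop where
  decay : BddAbove (decayValues γ w)
  nonpos : ∀ k, 1 ≤ k → w k ≤ 0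
  sum_nonneg : ∀ n : ℕ, 1 ≤ n → 0 ≤ w 0 + 2 * ∑ k ∈ Finset.Ico 1 n, w k
  mono : ∀ k, 1 ≤ k → w k ≤ w (k + 1)

theorem HasWeightProperties.isAdmissible {γ : ℝ} {w : ℕ → ℝ} (h : HasWeightProperties γ w) :
    IsAdmissible γ w := by
  refine ⟨h.decay, h.nonpos, fun n hn => ?_, h.mono⟩
  obtain ⟨ε, hε, h1⟩ := h.lower
  exact (pos_of_mul_pos_right (hε.trans_le (h1 n hn)) (by positivity)).le

/-- It suffices to bound the weights by a multiple of `(1 + k) ^ (-(1 + γ))` eventually. -/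
theorem bddAbove_decayValues {γ : ℝ} {w : ℕ → ℝ} (N : ℕ) (C : ℝ)
    (h : ∀ k, N ≤ k → |w k| * (1 + (k : ℝ)) ^ (1 + γ) ≤ C) : BddAbove (decayValues γ w) := by
  refine ⟨C ⊔ ∑ k ∈ Finset.range N, |w k| * (1 + (k : ℝ)) ^ (1 + γ), ?_⟩
  rintro _ ⟨k, rfl⟩
  rcases le_or_gt N k with hk | hk
  · exact (h k hk).trans le_sup_left
  · exact (Finset.single_le_sum (f := fun k : ℕ => |w k| * (1 + (k : ℝ)) ^ (1 + γ))
      (fun _ _ => by positivity) (Finset.mem_range.2 hk)).trans le_sup_right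

/-- A sequence with ratios `1 - p / (k + c)` decays like `k ^ (-p)`. -/
theorem abs_mul_rpow_le_of_ratio {p c : ℝ} (hp : 0 ≤ p) (hc : 0 < c) {w : ℕ → ℝ} {N : ℕ}
    (h0 : ∀ k, N ≤ k → 0 ≤ 1 - p / (k + c))
    (h : ∀ k, N ≤ k → w (k + 1) = (1 - p / (k + c)) * w k) :
    ∀ k, N ≤ k → |w k| * ((k : ℝ) + c) ^ p ≤ |w N| * ((N : ℝ) + c) ^ p := by
  intro k hk
  induction k, hk using Nat.le_induction with
  | base => exact le_rfl
  | succ k hk ih =>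
    refine le_trans ?_ ih
    rw [h k hk, abs_mul, abs_of_nonneg (h0 k hk), mul_right_comm, mul_comm]
    refine mul_le_mul_of_nonneg_left ?_ (abs_nonneg _)
    have hkc : 0 < (k : ℝ) + c := by positivity
    have e : ((k + 1 : ℕ) : ℝ) + c = (k + c) * (1 + 1 / (k + c)) := by
      field_simp; push_cast; ring
    rw [e, Real.mul_rpow hkc.le (by positivity)]
    -- The growth of `(k + c) ^ p` and the ratio of the weights are bounded by reciprocal
    -- exponentials, so `|w k| (k + c) ^ p` does not increase.
    have h1 : (1 + 1 / ((k : ℝ) + c)) ^ p ≤ Real.exp (p / (k + c)) := by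
      have := Real.add_one_le_exp (1 / ((k : ℝ) + c))
      calc (1 + 1 / ((k : ℝ) + c)) ^ p ≤ Real.exp (1 / ((k : ℝ) + c)) ^ p :=
            Real.rpow_le_rpow (by positivity) (by linarith) hp
        _ = _ := by rw [← Real.exp_mul]; congr 1; ring
    have h2 : 1 - p / (k + c) ≤ Real.exp (-(p / (k + c))) := Real.one_sub_le_exp_neg _
    calc (1 - p / (k + c)) * (((k : ℝ) + c) ^ p * (1 + 1 / ((k : ℝ) + c)) ^ p)
        ≤ Real.exp (-(p / (k + c))) * (((k : ℝ) + c) ^ p * Real.exp (p / (k + c))) := by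
          gcongr
      _ = ((k : ℝ) + c) ^ p := by
          rw [mul_left_comm, ← Real.exp_add]; simp

theorem centredWeight_isAdmissible {γ : ℝ} (h1 : 1 < γ) (h2 : γ < 2) :
    IsAdmissible γ (centredWeight γ) := by
  set w := centredWeight γ with hw
  have hrec : ∀ k : ℕ, w (k + 1) = (1 - (γ + 1) / (γ / 2 + k + 1)) * w k := fun k => rfl
  have hrec' : ∀ k : ℕ, (k + 1 + γ / 2) * w (k + 1) = (k - γ / 2) * w k := fun k => by
    have : γ / 2 + k + 1 ≠ 0 := by positivity
    rw [hrec]; field_simp; ring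
  have h0 : 0 < w 0 := by
    have : 0 < Real.Gamma (γ + 1) := Real.Gamma_pos_of_pos (by linarith)
    have : 0 < Real.Gamma (γ / 2 + 1) := Real.Gamma_pos_of_pos (by linarith)
    change 0 < Real.Gamma (γ + 1) / Real.Gamma (γ / 2 + 1) ^ 2
    positivity
  have hneg : ∀ k, 1 ≤ k → w k ≤ 0 := by
    intro k hk
    induction k, hk using Nat.le_induction with
    | base =>
      have := hrec' 0
      norm_num at this
      by_contra! h
      nlinarith
    | succ k hk ih =>
      have h3 := hrec' k
      have hk' : (1 : ℝ) ≤ k := by exact_mod_cast hk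
      by_contra! h
      have : 0 < (k + 1 + γ / 2) * w (k + 1) := by positivity
      nlinarith [mul_nonneg (by linarith : (0 : ℝ) ≤ k - γ / 2) (neg_nonneg.2 ih)]
  -- The recurrence telescopes, so the sign of a row sum is read off from the next weight.
  have hsum : ∀ n : ℕ, γ / 2 * (w 0 + 2 * ∑ k ∈ Finset.Ico 1 (n + 1), w k)
      = -((n + 1 + γ / 2) * w (n + 1)) := by
    intro n
    induction n with
    | zero => have := hrec' 0; norm_num at this ⊢; linarith
    | succ n ih =>
      rw [Finset.sum_Ico_succ_top (by omega)]
      have := hrec' (n + 1)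
      push_cast at this ⊢
      linarith
  refine ⟨?_, hneg, ?_, ?_⟩
  -- The start is `1` because the ratio at `k = 0` is negative; for `k ≥ 1 > γ / 2` it is
  -- nonnegative.
  · have hr := abs_mul_rpow_le_of_ratio (p := 1 + γ) (c := γ / 2 + 1) (w := w) (N := 1)
      (by linarith) (by linarith) (fun k hk => by
        have hk' : (1 : ℝ) ≤ k := by exact_mod_cast hk
        rw [sub_nonneg, div_le_one (by positivity)]; linarith)
      (fun k _ => by rw [hrec]; ring_nf)
    refine bddAbove_decayValues 1 _ fun k hk => le_trans ?_ (hr k hk)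
    gcongr ?_ * ?_ ^ _
    linarith
  · intro n hn
    obtain ⟨n, rfl⟩ := Nat.exists_eq_add_of_le' hn
    have h3 := hsum n
    have h4 := hneg (n + 1) (by omega)
    have h5 : 0 ≤ (n + 1 + γ / 2) * -w (n + 1) := mul_nonneg (by positivity) (by linarith)
    refine nonneg_of_mul_nonneg_right (a := γ / 2) ?_ (by linarith)
    linarith
  · intro k hk
    have h3 := hneg k hk
    rw [hrec]
    have : 0 ≤ (γ + 1) / (γ / 2 + k + 1) := by positivity
    nlinarith

theorem cos_mul_pi_div_two_neg {γ : ℝ} (h1 : 1 < γ) (h2 : γ < 2) :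
    Real.cos (γ * Real.pi / 2) < 0 :=
  Real.cos_neg_of_pi_div_two_lt_of_lt (by nlinarith [Real.pi_pos]) (by nlinarith [Real.pi_pos])

theorem IsAdmissible.const_mul {γ : ℝ} {w : ℕ → ℝ} (h : IsAdmissible γ w) {C : ℝ} (hC : 0 ≤ C) :
    IsAdmissible γ (fun k => C * w k) := by
  refine ⟨?_, fun k hk => mul_nonpos_of_nonneg_of_nonpos hC (h.nonpos k hk), fun n hn => ?_,
    fun k hk => mul_le_mul_of_nonneg_left (h.mono k hk) hC⟩
  · obtain ⟨b, hb⟩ := h.decay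
    refine bddAbove_decayValues 0 (C * b) fun k _ => ?_
    rw [abs_mul, abs_of_nonneg hC, mul_assoc]
    exact mul_le_mul_of_nonneg_left (hb ⟨k, rfl⟩) hC
  · rw [← Finset.mul_sum]
    have := mul_nonneg hC (h.sum_nonneg n hn)
    linarith

/-- Folding `g (-1), g 0, g 1, …` around the index `1` turns partial sums of `g` into the row sums
of the weights. -/
theorem folded_sum (g : ℕ → ℝ) (n : ℕ) :
    2 * g 1 + 2 * ∑ k ∈ Finset.Ico 1 (n + 2),
      (if k = 0 then 2 * g 1 else if k = 1 then g 0 + g 2 else g (k + 1))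
      = 2 * ∑ k ∈ Finset.range (n + 3), g k := by
  induction n with
  | zero => simp [Finset.sum_range_succ]; ring
  | succ n ih =>
    rw [Finset.sum_Ico_succ_top (by omega), mul_add, ← add_assoc, ih,
      Finset.sum_range_succ _ (n + 3), if_neg (by omega), if_neg (by omega)]
    ring

/-- The Grünwald and the spline weights are both of this folded form up to a positive factor. The
only condition not inherited index by index from `g` is `hmono1`, the comparison of the folded entry
with its successor. -/
theorem folded_isAdmissible {γ : ℝ} {g : ℕ → ℝ} (h1 : 0 ≤ g 1)
    (hneg : ∀ k, 3 ≤ k → g k ≤ 0) (hmono : ∀ k, 3 ≤ k → g k ≤ g (k + 1))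
    (hmono1 : g 0 + g 2 ≤ g 3) (hsum : ∀ n, 0 ≤ ∑ k ∈ Finset.range (n + 3), g k) (C : ℝ)
    (hdec : ∀ k, 4 ≤ k → |g k| * (k : ℝ) ^ (1 + γ) ≤ C) :
    IsAdmissible γ (fun k => if k = 0 then 2 * g 1 else if k = 1 then g 0 + g 2 else g (k + 1)) := by
  refine ⟨?_, ?_, ?_, ?_⟩
  · refine bddAbove_decayValues 3 C fun k hk => ?_
    have := hdec (k + 1) (by omega)
    rw [if_neg (by omega), if_neg (by omega)]
    push_cast at this
    rwa [add_comm (1 : ℝ)]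
  · intro k hk
    rcases hk.eq_or_lt with rfl | hk
    · simpa using hmono1.trans (hneg 3 le_rfl)
    · simpa [show k ≠ 0 by omega, show k ≠ 1 by omega] using hneg (k + 1) (by omega)
  · intro n hn
    obtain ⟨n, rfl⟩ := Nat.exists_eq_add_of_le' hn
    rcases n with _ | n
    · simpa using h1
    · have h2 := folded_sum g n
      have h3 := hsum n
      rw [if_pos rfl]
      linarith
  · intro k hk
    rcases hk.eq_or_lt with rfl | hk
    · simpa using hmono1
    · simpa [show k ≠ 0 by omega, show k ≠ 1 by omega] using hmono (k + 1) (by omega)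

theorem grunwaldWeight_isAdmissible {γ : ℝ} (h1 : 1 < γ) (h2 : γ < 2) :
    IsAdmissible γ (grunwaldWeight γ) := by
  set g := grunwaldCoeff γ with hg
  have hrec : ∀ k : ℕ, g (k + 1) = (1 - (γ + 1) / (k + 1)) * g k := fun k => rfl
  have hrec' : ∀ k : ℕ, ((k : ℝ) + 1) * g (k + 1) = (k - γ) * g k := fun k => by
    rw [hrec]; field_simp; ring
  have e0 : g 0 = -1 := rfl
  have e1 : g 1 = γ := by have := hrec' 0; norm_num [e0] at this; linarith
  have e2 : g 2 = γ * (1 - γ) / 2 := by have := hrec' 1; norm_num [e1] at this; linarith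
  have hneg : ∀ k, 2 ≤ k → g k ≤ 0 := by
    intro k hk
    induction k, hk using Nat.le_induction with
    | base => rw [e2]; nlinarith
    | succ k hk ih =>
      have h3 := hrec' k
      have hk' : (2 : ℝ) ≤ k := by exact_mod_cast hk
      by_contra! h
      have : 0 < ((k : ℝ) + 1) * g (k + 1) := by positivity
      nlinarith [mul_nonneg (by linarith : (0 : ℝ) ≤ k - γ) (neg_nonneg.2 ih)]
  have hmono : ∀ k, 2 ≤ k → g k ≤ g (k + 1) := by
    intro k hk
    have h3 := hneg k hk
    rw [hrec]
    have : 0 ≤ (γ + 1) / ((k : ℝ) + 1) := by positivity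
    nlinarith
  have hsum : ∀ n : ℕ, γ * ∑ k ∈ Finset.range n, g k = -(n * g n) := by
    intro n
    induction n with
    | zero => simp
    | succ n ih =>
      rw [Finset.sum_range_succ]
      have := hrec' n
      push_cast
      linarith
  have hr := abs_mul_rpow_le_of_ratio (p := 1 + γ) (c := 1) (w := g) (N := 2)
      (by linarith) (by linarith) (fun k hk => by
        have hk' : (2 : ℝ) ≤ k := by exact_mod_cast hk
        rw [sub_nonneg, div_le_one (by positivity)]; linarith)
      (fun k _ => by rw [hrec]; ring_nf)
  refine (folded_isAdmissible (g := g) (by rw [e1]; linarith)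
    (fun k hk => hneg k (by omega)) (fun k hk => hmono k (by omega)) ?_ ?_ _
    (fun k hk => le_trans ?_ (hr k (by omega)))).const_mul (C := -1 / (2 * Real.cos (γ * Real.pi / 2)))
    ?_
  · have := hmono 2 le_rfl
    rw [e0]; linarith
  · intro n
    have h3 := hsum (n + 3)
    have h4 := hneg (n + 3) (by omega)
    refine nonneg_of_mul_nonneg_right (a := γ) ?_ (by linarith)
    rw [h3, ← mul_neg]
    exact mul_nonneg (by positivity) (by linarith)
  · gcongr ?_ * ?_ ^ _
    linarith
  · exact div_nonneg_of_nonpos (by norm_num) (by linarith [cos_mul_pi_div_two_neg h1 h2])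

/-- Put `s = 2 ^ (-t/2)`. Since `4/9 ≤ 1/2`, `(2/3) ^ t ≤ s`, and `4 s² - 9 s + 5 = (1 - s)(5 - 4
s)`. -/
theorem four_mul_two_rpow_neg_add_five_ge {t : ℝ} (h0 : 0 ≤ t) :
    9 * (2 / 3 : ℝ) ^ t ≤ 4 * (2 : ℝ) ^ (-t) + 5 := by
  set s : ℝ := ((2 : ℝ) ^ (-t)) ^ (1 / 2 : ℝ) with hs
  have hp : (0 : ℝ) < 2 ^ (-t) := by positivity
  have hs2 : s ^ 2 = 2 ^ (-t) := by
    rw [hs, ← Real.rpow_natCast, ← Real.rpow_mul hp.le]; norm_num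
  have hs1 : s ≤ 1 := Real.rpow_le_one hp.le
    (Real.rpow_le_one_of_one_le_of_nonpos (by norm_num) (by linarith)) (by norm_num)
  have hs0 : 0 ≤ s := by positivity
  have : (2 / 3 : ℝ) ^ t ≤ s := by
    have hy : (0 : ℝ) ≤ (2 / 3 : ℝ) ^ t := by positivity
    refine le_of_sq_le_sq ?_ hs0
    rw [hs2, ← Real.rpow_natCast, ← Real.rpow_mul (by norm_num), mul_comm,
      Real.rpow_mul (by norm_num), Real.rpow_neg (by norm_num), ← Real.inv_rpow (by norm_num)]
    exact Real.rpow_le_rpow (by positivity) (by norm_num) h0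
  nlinarith [mul_nonneg (sub_nonneg.2 hs1) (by linarith : 0 ≤ 5 - 4 * s)]

/-- This is the folded monotonicity condition for the spline weights. The left side vanishes at `β =
2` and is increasing on `(-∞, 2]`; the derivative is handled with `3⁵ ≤ 2⁸`. -/
theorem rpow_comb_le {β : ℝ} (h2 : β ≤ 2) :
    (4 : ℝ) ^ β - 5 * 3 ^ β + 10 * 2 ^ β - 11 ≤ 0 := by
  set φ : ℝ → ℝ := fun x => (4 : ℝ) ^ x - 5 * 3 ^ x + 10 * 2 ^ x - 11 with hφ
  have hd : ∀ x, HasDerivAt φ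
      ((4 : ℝ) ^ x * Real.log 4 - 5 * (3 ^ x * Real.log 3) + 10 * (2 ^ x * Real.log 2)) x := by
    intro x
    exact ((((Real.hasStrictDerivAt_const_rpow (by norm_num) x).hasDerivAt).sub
      (((Real.hasStrictDerivAt_const_rpow (by norm_num) x).hasDerivAt).const_mul 5)).add
      (((Real.hasStrictDerivAt_const_rpow (by norm_num) x).hasDerivAt).const_mul 10)).sub_const 11
  have hl : 5 * Real.log 3 ≤ 8 * Real.log 2 := by
    have h3 : Real.log ((3 : ℝ) ^ 5) ≤ Real.log ((2 : ℝ) ^ 8) :=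
      Real.log_le_log (by norm_num) (by norm_num)
    rw [Real.log_pow, Real.log_pow] at h3
    exact_mod_cast h3
  have hl4 : Real.log 4 = 2 * Real.log 2 := by
    rw [show (4 : ℝ) = 2 ^ 2 by norm_num, Real.log_pow]; norm_num
  have hmono : MonotoneOn φ (Set.Iic 2) := by
    refine monotoneOn_of_deriv_nonneg (convex_Iic 2)
      (fun x _ => (hd x).continuousAt.continuousWithinAt)
      (fun x _ => (hd x).differentiableAt.differentiableWithinAt) fun x hx => ?_
    rw [interior_Iic, Set.mem_Iio] at hx
    rw [(hd x).deriv, hl4]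
    have h4 : (4 : ℝ) ^ x = 2 ^ x * 2 ^ x := by
      rw [← Real.mul_rpow (by norm_num) (by norm_num)]; norm_num
    have h3 : (3 : ℝ) ^ x = 2 ^ x * ((9 / 4) * (2 / 3) ^ (2 - x)) := by
      rw [Real.rpow_sub (by norm_num), show (2 / 3 : ℝ) = (3 / 2)⁻¹ by norm_num,
        Real.inv_rpow (by norm_num) x, Real.div_rpow (by norm_num) (by norm_num)]
      have : (0 : ℝ) < 2 ^ x := by positivity
      field_simp
      norm_num
    have h2' : (2 : ℝ) ^ x = 4 * 2 ^ (-(2 - x)) := by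
      rw [neg_sub, Real.rpow_sub (by norm_num)]; norm_num; ring
    have key := four_mul_two_rpow_neg_add_five_ge (t := 2 - x) (by linarith)
    have hpos : (0 : ℝ) < 2 ^ x := by positivity
    have hlog : 0 < Real.log 2 := Real.log_pos (by norm_num)
    rw [h4, h3]
    have hz : (0 : ℝ) < (2 / 3) ^ (2 - x) := by positivity
    have : (2 : ℝ) ^ x * 2 ^ x * (2 * Real.log 2)
        - 5 * (2 ^ x * (9 / 4 * (2 / 3) ^ (2 - x)) * Real.log 3) + 10 * (2 ^ x * Real.log 2)
        = 2 ^ x * ((2 * 2 ^ x + 10) * Real.log 2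
          - (9 / 4 * (2 / 3) ^ (2 - x)) * (5 * Real.log 3)) := by ring
    rw [this]
    refine mul_nonneg hpos.le ?_
    have h5 : (9 / 4 * (2 / 3 : ℝ) ^ (2 - x)) * (5 * Real.log 3)
        ≤ (9 / 4 * (2 / 3 : ℝ) ^ (2 - x)) * (8 * Real.log 2) := by gcongr
    nlinarith
  have := hmono (a := β) (b := 2) h2 Set.self_mem_Iic h2
  have e : φ 2 = 0 := by simp only [hφ]; norm_num
  rw [e] at this
  exact this

/-- With `β = 3 - γ`, the coefficients from index `3` on are negated fourth differences of `t ^ β`,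
and the partial sums are negated third differences. All signs are therefore those of `β (β - 1) (β -
2) ⋯` with `1 < β < 2`. -/
theorem splineWeight_isAdmissible {γ : ℝ} (h1 : 1 < γ) (h2 : γ < 2) :
    IsAdmissible γ (splineWeight γ) := by
  obtain ⟨β, rfl⟩ : ∃ β, γ = 3 - β := ⟨3 - γ, by ring⟩
  have hb1 : 1 < β := by linarith
  have hb2 : β < 2 := by linarith
  set p := splineCoeff (3 - β) with hp
  have hβ : 3 - (3 - β) = β := by ring
  have e0 : p 0 = -1 := by simp [hp, splineCoeff]
  have e1 : p 1 = 4 - 2 ^ β := by simp [hp, splineCoeff]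
  have e2 : p 2 = -3 ^ β + 4 * 2 ^ β - 6 := by simp [hp, splineCoeff]
  have hz : (0 : ℝ) ^ β = 0 := Real.zero_rpow (by linarith)
  have e3 : ∀ k : ℕ, p (k + 3) = -(fwdDiff (1 : ℝ))^[4] (fun t : ℝ => t ^ β) k := by
    intro k
    simp only [hp, splineCoeff, hβ, Function.iterate_succ, Function.iterate_zero, Function.comp,
      id, fwdDiff]
    rw [if_neg (by omega), if_neg (by omega), if_neg (by omega)]
    push_cast
    ring_nf
  have hP3 : ∏ i ∈ Finset.range 3, (β - (i : ℕ)) ≤ 0 := by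
    simp only [Finset.prod_range_succ, Finset.prod_range_zero]
    push_cast
    have : 0 ≤ β * (β - 1) * (2 - β) := mul_nonneg (mul_nonneg (by linarith) (by linarith)) (by linarith)
    linarith
  have hP4 : 0 ≤ ∏ i ∈ Finset.range 4, (β - (i : ℕ)) := by
    rw [Finset.prod_range_succ]
    push_cast
    exact mul_nonneg_of_nonpos_of_nonpos hP3 (by linarith)
  have hP5 : ∏ i ∈ Finset.range 5, (β - (i : ℕ)) ≤ 0 := by
    rw [Finset.prod_range_succ]
    push_cast
    exact mul_nonpos_of_nonneg_of_nonpos hP4 (by linarith)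
  have hneg : ∀ k, 3 ≤ k → p k ≤ 0 := by
    intro k hk
    obtain ⟨k, rfl⟩ := Nat.exists_eq_add_of_le' hk
    obtain ⟨ξ, hξ, -, h⟩ := exists_fwdDiff_iter_rpow (n := 4) (by norm_num)
      (Nat.cast_nonneg (α := ℝ) k) (by linarith : 0 < β)
    rw [e3, h, neg_nonpos]
    exact mul_nonneg hP4 (by positivity)
  have hmono : ∀ k, 3 ≤ k → p k ≤ p (k + 1) := by
    intro k hk
    obtain ⟨k, rfl⟩ := Nat.exists_eq_add_of_le' hk
    obtain ⟨ξ, hξ, -, h⟩ := exists_fwdDiff_iter_rpow (n := 5) (by norm_num)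
      (Nat.cast_nonneg (α := ℝ) k) (by linarith : 0 < β)
    rw [Function.iterate_succ_apply', fwdDiff] at h
    have h3 : (∏ i ∈ Finset.range 5, (β - (i : ℕ))) * ξ ^ (β - (5 : ℕ)) ≤ 0 :=
      mul_nonpos_of_nonpos_of_nonneg hP5 (by positivity)
    rw [show k + 3 + 1 = (k + 1) + 3 by ring, e3, e3]
    push_cast
    linarith
  have hsum : ∀ n : ℕ, ∑ k ∈ Finset.range (n + 3), p k
      = -(fwdDiff (1 : ℝ))^[3] (fun t : ℝ => t ^ β) n := by
    intro n
    induction n with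
    | zero =>
      simp only [Finset.sum_range_succ, Finset.sum_range_zero, e0, e1, e2, Function.iterate_succ,
        Function.iterate_zero, Function.comp, id, fwdDiff]
      norm_num [hz]
      ring
    | succ n ih =>
      rw [show n + 1 + 3 = (n + 3) + 1 by ring, Finset.sum_range_succ, ih, e3,
        Function.iterate_succ_apply' _ 3, fwdDiff]
      push_cast
      ring
  have hdec : ∀ k, 4 ≤ k → |p k| * (k : ℝ) ^ (1 + (3 - β))
      ≤ (∏ i ∈ Finset.range 4, (β - (i : ℕ))) * 4 ^ (1 + (3 - β)) := by
    intro k hk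
    obtain ⟨k, rfl⟩ := Nat.exists_eq_add_of_le' (show 3 ≤ k by omega)
    have hk0 : (1 : ℝ) ≤ k := by
      have : 1 ≤ k := by omega
      exact_mod_cast this
    obtain ⟨ξ, hξ, hξ', h⟩ := exists_fwdDiff_iter_rpow (n := 4) (by norm_num)
      (Nat.cast_nonneg (α := ℝ) k) (by linarith : 0 < β)
    -- Discarding index `3` ensures `ξ ≥ k ≥ 1`, hence `k + 3 ≤ 4 ξ`; at `k = 0` the mean value
    -- point has no such lower bound.
    have h3 : ξ ^ (β - (4 : ℕ)) * ((k + 3 : ℕ) : ℝ) ^ (1 + (3 - β)) ≤ 4 ^ (1 + (3 - β)) := by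
      have h4 : ((k + 3 : ℕ) : ℝ) ≤ ξ * 4 := by push_cast; linarith
      calc ξ ^ (β - (4 : ℕ)) * ((k + 3 : ℕ) : ℝ) ^ (1 + (3 - β))
          ≤ ξ ^ (β - (4 : ℕ)) * (ξ * 4) ^ (1 + (3 - β)) := by
            gcongr
        _ = 4 ^ (1 + (3 - β)) := by
            rw [Real.mul_rpow hξ.le (by norm_num), ← mul_assoc, ← Real.rpow_add hξ,
              show β - (4 : ℕ) + (1 + (3 - β)) = 0 by push_cast; ring, Real.rpow_zero, one_mul]
    rw [e3, abs_neg, h, abs_of_nonneg (mul_nonneg hP4 (by positivity)), mul_assoc]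
    exact mul_le_mul_of_nonneg_left h3 hP4
  refine (folded_isAdmissible (g := p) ?_ hneg hmono ?_ ?_ _ hdec).const_mul
    (C := -1 / (2 * Real.cos ((3 - β) * Real.pi / 2) * Real.Gamma (4 - (3 - β)))) ?_
  · have : (2 : ℝ) ^ β ≤ 2 ^ (2 : ℝ) := Real.rpow_le_rpow_of_exponent_le (by norm_num) hb2.le
    norm_num at this
    rw [e1]; linarith
  · have h3 := rpow_comb_le hb2.le
    have h4 := e3 0
    simp only [Function.iterate_succ, Function.iterate_zero, Function.comp, id, fwdDiff] at h4
    norm_num [hz] at h4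
    rw [h4, e0, e2]
    linarith
  · intro n
    obtain ⟨ξ, hξ, -, h⟩ := exists_fwdDiff_iter_rpow (n := 3) (by norm_num)
      (Nat.cast_nonneg (α := ℝ) n) (by linarith : 0 < β)
    rw [hsum, h, neg_nonneg]
    exact mul_nonpos_of_nonpos_of_nonneg hP3 (by positivity)
  · have hc := cos_mul_pi_div_two_neg h1 h2
    have hG : 0 < Real.Gamma (4 - (3 - β)) := Real.Gamma_pos_of_pos (by linarith)
    exact div_nonneg_of_nonpos (by norm_num) (by nlinarith)

theorem IsRieszWeight.isAdmissible {γ : ℝ} {w : ℕ → ℝ} (h : IsRieszWeight γ w) (h1 : 1 < γ)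
    (h2 : γ < 2) : IsAdmissible γ w := by
  cases h with
  | centred => exact centredWeight_isAdmissible h1 h2
  | grunwald => exact grunwaldWeight_isAdmissible h1 h2
  | spline => exact splineWeight_isAdmissible h1 h2
  | general _ hw => exact hw.isAdmissible

end RieszGMRES

/-! ### Quadratic forms of symmetric matrices with variable coefficients -/

section QuadraticForms

open Matrix

variable {ι : Type*} [Fintype ι]

theorem Matrix.IsSymm.sum_mul_swap {B : Matrix ι ι ℝ} (hB : B.IsSymm) (f : ι → ι → ℝ) :
    ∑ j, ∑ k, B j k * f k j = ∑ j, ∑ k, B j k * f j k := by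
  rw [Finset.sum_comm]
  exact Finset.sum_congr rfl fun j _ => Finset.sum_congr rfl fun k _ => by rw [hB.apply]

theorem dotProduct_mulVec_eq_sum (B : Matrix ι ι ℝ) (x y : ι → ℝ) :
    x ⬝ᵥ (B *ᵥ y) = ∑ j, ∑ k, B j k * (x j * y k) := by
  simp only [dotProduct, mulVec, Finset.mul_sum]
  exact Finset.sum_congr rfl fun j _ => Finset.sum_congr rfl fun k _ => by ring

theorem dotProduct_diagonal_mul_mulVec_eq_sum [DecidableEq ι] (B : Matrix ι ι ℝ) (d x y : ι → ℝ) :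
    x ⬝ᵥ ((diagonal d * B) *ᵥ y) = ∑ j, ∑ k, B j k * (d j * x j * y k) := by
  rw [dotProduct_mulVec_eq_sum]
  simp only [diagonal_mul]
  exact Finset.sum_congr rfl fun j _ => Finset.sum_congr rfl fun k _ => by ring

/-- A symmetric matrix with weakly dominant diagonal is positive semidefinite. -/
theorem dotProduct_mulVec_nonneg_of_sum_abs_le {B : Matrix ι ι ℝ} (hB : B.IsSymm)
    (h : ∀ j, ∑ k, |B j k| ≤ 2 * B j j) (x : ι → ℝ) : 0 ≤ x ⬝ᵥ (B *ᵥ x) := by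
  classical
  rw [dotProduct_mulVec_eq_sum]
  have h1 : ∑ j, ∑ k, |B j k| * ((x j ^ 2 + x k ^ 2) / 2) = ∑ j, (∑ k, |B j k|) * x j ^ 2 := by
    have h2 := (show (B.map abs).IsSymm by
      ext i j; simp [hB.apply]).sum_mul_swap (fun j _ => x j ^ 2)
    simp only [map_apply] at h2
    simp only [Finset.sum_mul]
    have : ∀ j k, |B j k| * ((x j ^ 2 + x k ^ 2) / 2)
        = (|B j k| * x j ^ 2) / 2 + (|B j k| * x k ^ 2) / 2 := fun j k => by ring
    simp only [this, Finset.sum_add_distrib, ← Finset.sum_div, h2]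
    ring
  -- Every summand is nonnegative, and the diagonal one alone equals the right-hand side.
  have h3 : ∀ j, ∑ k, (B j k * (x j * x k) + |B j k| * ((x j ^ 2 + x k ^ 2) / 2))
      ≥ 2 * B j j * x j ^ 2 := by
    intro j
    have h4 : 0 ≤ B j j := by
      have : 0 ≤ ∑ k, |B j k| := Finset.sum_nonneg fun _ _ => abs_nonneg _
      linarith [h j]
    refine le_trans (le_of_eq ?_) (Finset.single_le_sum
      (f := fun k => B j k * (x j * x k) + |B j k| * ((x j ^ 2 + x k ^ 2) / 2))
      (fun k _ => ?_) (Finset.mem_univ j))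
    · rw [abs_of_nonneg h4]; ring
    · have h5 : |B j k * (x j * x k)| ≤ |B j k| * ((x j ^ 2 + x k ^ 2) / 2) := by
        rw [abs_mul]
        refine mul_le_mul_of_nonneg_left ?_ (abs_nonneg _)
        rw [abs_le]
        constructor <;> nlinarith [sq_nonneg (x j + x k), sq_nonneg (x j - x k)]
      linarith [neg_abs_le (B j k * (x j * x k))]
  have h6 := Finset.sum_le_sum fun j (_ : j ∈ Finset.univ) => h3 j
  have h7 : ∑ j, (∑ k, |B j k|) * x j ^ 2 ≤ ∑ j, 2 * B j j * x j ^ 2 :=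
    Finset.sum_le_sum fun j _ => mul_le_mul_of_nonneg_right (h j) (sq_nonneg _)
  simp only [Finset.sum_add_distrib, h1] at h6
  linarith

theorem sum_sum_half_le_of_sum_le {B : Matrix ι ι ℝ} (hB : B.IsSymm) {d : ι → ℝ}
    {E : ℝ} (hE : ∀ j, ∑ k, |B j k| * (d j - d k) ^ 2 ≤ E) (x : ι → ℝ) :
    ∑ j, ∑ k, |B j k| * ((d j - d k) ^ 2 * ((x j ^ 2 + x k ^ 2) / 2)) ≤ E * (x ⬝ᵥ x) := by
  have h2 := (show (B.map abs).IsSymm by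
    ext i j; simp [hB.apply]).sum_mul_swap (fun j k => (d j - d k) ^ 2 * x j ^ 2)
  simp only [map_apply] at h2
  have h1 : ∑ j, ∑ k, |B j k| * ((d j - d k) ^ 2 * ((x j ^ 2 + x k ^ 2) / 2))
      = ∑ j, (∑ k, |B j k| * (d j - d k) ^ 2) * x j ^ 2 := by
    simp only [Finset.sum_mul]
    have : ∀ j k, |B j k| * ((d j - d k) ^ 2 * ((x j ^ 2 + x k ^ 2) / 2))
        = (|B j k| * ((d j - d k) ^ 2 * x j ^ 2)) / 2
          + (|B j k| * ((d k - d j) ^ 2 * x k ^ 2)) / 2 := fun j k => by ring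
    simp only [this, Finset.sum_add_distrib, ← Finset.sum_div, h2]
    simp only [← mul_assoc]
    ring
  rw [h1, dotProduct, Finset.mul_sum]
  refine Finset.sum_le_sum fun j _ => ?_
  rw [← pow_two]
  exact mul_le_mul_of_nonneg_right (hE j) (sq_nonneg _)

/-- The quadratic form of a symmetric matrix, split into its row sums and its differences. -/
theorem Matrix.IsSymm.dotProduct_diagonal_mul_mulVec [DecidableEq ι] {B : Matrix ι ι ℝ}
    (hB : B.IsSymm) (d x : ι → ℝ) :
    x ⬝ᵥ ((diagonal d * B) *ᵥ x) = ∑ j, (∑ k, B j k) * (d j * x j ^ 2)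
      - (∑ j, ∑ k, B j k * ((x j - x k) * (d j * x j - d k * x k))) / 2 := by
  rw [dotProduct_diagonal_mul_mulVec_eq_sum]
  have h1 := hB.sum_mul_swap (fun j _ => d j * x j ^ 2)
  have h2 := hB.sum_mul_swap (fun j k => d j * x j * x k)
  have : ∀ j k, B j k * ((x j - x k) * (d j * x j - d k * x k))
      = B j k * (d j * x j ^ 2) + B j k * (d k * x k ^ 2) - B j k * (d j * x j * x k)
        - B j k * (d k * x k * x j) := fun j k => by ring
  simp only [this, Finset.sum_add_distrib, Finset.sum_sub_distrib, h1, h2, Finset.sum_mul]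
  ring

/-- Sign structure of a symmetric M-matrix: nonpositive off-diagonal entries and nonnegative row
sums. -/
structure Matrix.IsSymmDominant (B : Matrix ι ι ℝ) : Prop where
  symm : B.IsSymm
  offDiag : ∀ j k, j ≠ k → B j k ≤ 0
  rowSum : ∀ j, 0 ≤ ∑ k, B j k

variable [DecidableEq ι]

/-- For each pair, `(x_j - x_k)(d_j x_j - d_k x_k)` is the mean of `d_j, d_k` times `(x_j - x_k)²`
plus the cross term `(d_j - d_k)(x_j² - x_k²)/2`. The gap `κ` between `d` and `c` pays for the cross
term by Young's inequality. No sign of `c` or `d` is required. -/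
theorem Matrix.IsSymmDominant.le_dotProduct_diagonal_mul {B : Matrix ι ι ℝ}
    (hB : B.IsSymmDominant) {d : ι → ℝ} {c κ E : ℝ} (hκ : 0 < κ) (hd : ∀ j, c + κ ≤ d j)
    (hE : ∀ j, ∑ k, |B j k| * (d j - d k) ^ 2 ≤ E) (x : ι → ℝ) :
    c * (x ⬝ᵥ (B *ᵥ x)) - E / (8 * κ) * (x ⬝ᵥ x) ≤ x ⬝ᵥ ((diagonal d * B) *ᵥ x) := by
  have h1 := hB.symm.dotProduct_diagonal_mul_mulVec d x
  have h2 := hB.symm.dotProduct_diagonal_mul_mulVec (fun _ => (1 : ℝ)) x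
  rw [show diagonal (fun _ : ι => (1 : ℝ)) = 1 from diagonal_one, one_mul] at h2
  have h3 := sum_sum_half_le_of_sum_le hB.symm hE x
  have h4 : ∀ j k, B j k * ((x j - x k) * (d j * x j - d k * x k))
      ≤ c * (B j k * ((x j - x k) * (1 * x j - 1 * x k)))
        + |B j k| * ((d j - d k) ^ 2 * ((x j ^ 2 + x k ^ 2) / 2)) / (4 * κ) := by
    intro j k
    rcases eq_or_ne j k with rfl | hjk
    · simp
    · rw [abs_of_nonpos (hB.offDiag j k hjk)]
      have h5 : 0 ≤ (x j - x k) * (d j * x j - d k * x k) - c * ((x j - x k) * (1 * x j - 1 * x k))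
          + (d j - d k) ^ 2 * ((x j ^ 2 + x k ^ 2) / 2) / (4 * κ) := by
        have h6 : (x j - x k) * (d j * x j - d k * x k) - c * ((x j - x k) * (1 * x j - 1 * x k))
          + (d j - d k) ^ 2 * ((x j ^ 2 + x k ^ 2) / 2) / (4 * κ)
          = ((d j - (c + κ)) + (d k - (c + κ))) / 2 * (x j - x k) ^ 2
            + κ * ((x j - x k) + (d j - d k) * (x j + x k) / (4 * κ)) ^ 2
            + (d j - d k) ^ 2 * (x j - x k) ^ 2 / (16 * κ) := by
          field_simp; ring
        rw [h6]
        have := hd j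
        have := hd k
        have : 0 ≤ ((d j - (c + κ)) + (d k - (c + κ))) / 2 := by linarith
        positivity
      have h7 := mul_nonneg (neg_nonneg.2 (hB.offDiag j k hjk)) h5
      have h8 : -B j k * ((x j - x k) * (d j * x j - d k * x k) - c * ((x j - x k) * (1 * x j - 1 * x k))
          + (d j - d k) ^ 2 * ((x j ^ 2 + x k ^ 2) / 2) / (4 * κ))
          = -(B j k * ((x j - x k) * (d j * x j - d k * x k)))
            + c * (B j k * ((x j - x k) * (1 * x j - 1 * x k)))
            + -B j k * ((d j - d k) ^ 2 * ((x j ^ 2 + x k ^ 2) / 2)) / (4 * κ) := by ring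
      linarith
  have h9 := Finset.sum_le_sum fun j (_ : j ∈ Finset.univ) =>
    Finset.sum_le_sum fun k (_ : k ∈ Finset.univ) => h4 j k
  simp only [Finset.sum_add_distrib, ← Finset.mul_sum, ← Finset.sum_div] at h9
  have h10 : c * ∑ j, (∑ k, B j k) * (1 * x j ^ 2) ≤ ∑ j, (∑ k, B j k) * (d j * x j ^ 2) := by
    rw [Finset.mul_sum]
    refine Finset.sum_le_sum fun j _ => ?_
    have h11 : 0 ≤ d j - c := by linarith [hd j]
    have := mul_nonneg (hB.rowSum j) (mul_nonneg h11 (sq_nonneg (x j)))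
    linarith
  have h12 : (∑ j, ∑ k, |B j k| * ((d j - d k) ^ 2 * ((x j ^ 2 + x k ^ 2) / 2))) / (4 * κ)
      ≤ E * (x ⬝ᵥ x) / (4 * κ) := by gcongr
  have h13 : E / (8 * κ) * (x ⬝ᵥ x) = E * (x ⬝ᵥ x) / (4 * κ) / 2 := by field_simp; ring
  rw [h1, h2, h13, mul_sub]
  linarith

theorem Matrix.IsSymmDominant.dotProduct_diagonal_mul_le {B : Matrix ι ι ℝ}
    (hB : B.IsSymmDominant) {d : ι → ℝ} {c κ E : ℝ} (hκ : 0 < κ) (hd : ∀ j, d j + κ ≤ c)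
    (hE : ∀ j, ∑ k, |B j k| * (d j - d k) ^ 2 ≤ E) (x : ι → ℝ) :
    x ⬝ᵥ ((diagonal d * B) *ᵥ x) ≤ c * (x ⬝ᵥ (B *ᵥ x)) + E / (8 * κ) * (x ⬝ᵥ x) := by
  have h := hB.le_dotProduct_diagonal_mul (d := -d) (c := -c) hκ
    (fun j => by have := hd j; simp only [Pi.neg_apply]; linarith)
    (fun j => by
      refine (Finset.sum_congr rfl fun k _ => ?_).trans_le (hE j)
      simp only [Pi.neg_apply]; ring) x
  rw [show diagonal (-d) = -diagonal d from (diagonal_neg d).symm, Matrix.neg_mul, neg_mulVec,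
    dotProduct_neg] at h
  linarith

/-- Symmetry of `B` turns the left side into half the sum of `B_jk (d_j - d_k)(x_j y_k - x_k y_j)`.
Writing `2(x_j y_k - x_k y_j) = (x_j - x_k)(y_j + y_k) - (x_j + x_k)(y_j - y_k)` exposes differences
of `x` and `y`, and Young's inequality with parameter `κ` finishes. -/
theorem Matrix.IsSymmDominant.dotProduct_diagonal_mul_skew_le {B : Matrix ι ι ℝ}
    (hB : B.IsSymmDominant) {d : ι → ℝ} {κ E : ℝ} (hκ : 0 < κ)
    (hE : ∀ j, ∑ k, |B j k| * (d j - d k) ^ 2 ≤ E) (x y : ι → ℝ) :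
    x ⬝ᵥ ((diagonal d * B) *ᵥ y) - y ⬝ᵥ ((diagonal d * B) *ᵥ x) ≤
      κ / 2 * (x ⬝ᵥ (B *ᵥ x) + y ⬝ᵥ (B *ᵥ y)) + E / (4 * κ) * (x ⬝ᵥ x + y ⬝ᵥ y) := by
  have hx := hB.symm.dotProduct_diagonal_mul_mulVec (fun _ => (1 : ℝ)) x
  have hy := hB.symm.dotProduct_diagonal_mul_mulVec (fun _ => (1 : ℝ)) y
  rw [show diagonal (fun _ : ι => (1 : ℝ)) = 1 from diagonal_one, one_mul] at hx hy
  have h3x := sum_sum_half_le_of_sum_le hB.symm hE x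
  have h3y := sum_sum_half_le_of_sum_le hB.symm hE y
  have h4 : ∀ j k, B j k * ((d j - d k) * (x j * y k - x k * y j))
      ≤ -(κ / 2 * (B j k * ((x j - x k) * (1 * x j - 1 * x k))))
        - (κ / 2 * (B j k * ((y j - y k) * (1 * y j - 1 * y k))))
        + |B j k| * ((d j - d k) ^ 2 * ((x j ^ 2 + x k ^ 2) / 2)) / (2 * κ)
        + |B j k| * ((d j - d k) ^ 2 * ((y j ^ 2 + y k ^ 2) / 2)) / (2 * κ) := by
    intro j k
    rcases eq_or_ne j k with rfl | hjk
    · simp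
    · rw [abs_of_nonpos (hB.offDiag j k hjk)]
      have h5 : 0 ≤ (d j - d k) * (x j * y k - x k * y j)
          + κ / 2 * (x j - x k) ^ 2 + κ / 2 * (y j - y k) ^ 2
          + (d j - d k) ^ 2 * ((x j ^ 2 + x k ^ 2) / 2) / (2 * κ)
          + (d j - d k) ^ 2 * ((y j ^ 2 + y k ^ 2) / 2) / (2 * κ) := by
        have h6 : (d j - d k) * (x j * y k - x k * y j)
          + κ / 2 * (x j - x k) ^ 2 + κ / 2 * (y j - y k) ^ 2
          + (d j - d k) ^ 2 * ((x j ^ 2 + x k ^ 2) / 2) / (2 * κ)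
          + (d j - d k) ^ 2 * ((y j ^ 2 + y k ^ 2) / 2) / (2 * κ)
          = κ / 2 * ((x j - x k) + (d j - d k) * (y j + y k) / (2 * κ)) ^ 2
            + κ / 2 * ((y j - y k) - (d j - d k) * (x j + x k) / (2 * κ)) ^ 2
            + (d j - d k) ^ 2 * ((x j - x k) ^ 2 + (y j - y k) ^ 2) / (8 * κ) := by
          field_simp; ring
        rw [h6]
        positivity
      have h7 := mul_nonneg (neg_nonneg.2 (hB.offDiag j k hjk)) h5
      linear_combination h7
  have h9 := Finset.sum_le_sum fun j (_ : j ∈ Finset.univ) =>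
    Finset.sum_le_sum fun k (_ : k ∈ Finset.univ) => h4 j k
  simp only [Finset.sum_add_distrib, Finset.sum_sub_distrib, Finset.sum_neg_distrib,
    ← Finset.mul_sum, ← Finset.sum_div] at h9
  have h10 : ∑ j, ∑ k, B j k * ((d j - d k) * (x j * y k - x k * y j))
      = 2 * (x ⬝ᵥ ((diagonal d * B) *ᵥ y) - y ⬝ᵥ ((diagonal d * B) *ᵥ x)) := by
    rw [dotProduct_diagonal_mul_mulVec_eq_sum, dotProduct_diagonal_mul_mulVec_eq_sum]
    have h1 := hB.symm.sum_mul_swap (fun j k => d j * x j * y k)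
    have h2 := hB.symm.sum_mul_swap (fun j k => d j * y j * x k)
    have : ∀ j k, B j k * ((d j - d k) * (x j * y k - x k * y j))
      = B j k * (d j * x j * y k) + B j k * (d k * x k * y j)
        - B j k * (d j * y j * x k) - B j k * (d k * y k * x j) := fun j k => by ring
    simp only [this, Finset.sum_add_distrib, Finset.sum_sub_distrib, h1, h2]
    ring
  have hrx : 0 ≤ ∑ j, (∑ k, B j k) * (1 * x j ^ 2) :=
    Finset.sum_nonneg fun j _ => mul_nonneg (hB.rowSum j) (by positivity)
  have hry : 0 ≤ ∑ j, (∑ k, B j k) * (1 * y j ^ 2) :=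
    Finset.sum_nonneg fun j _ => mul_nonneg (hB.rowSum j) (by positivity)
  have h12x : (∑ j, ∑ k, |B j k| * ((d j - d k) ^ 2 * ((x j ^ 2 + x k ^ 2) / 2))) / (2 * κ)
      ≤ E * (x ⬝ᵥ x) / (2 * κ) := by gcongr
  have h12y : (∑ j, ∑ k, |B j k| * ((d j - d k) ^ 2 * ((y j ^ 2 + y k ^ 2) / 2))) / (2 * κ)
      ≤ E * (y ⬝ᵥ y) / (2 * κ) := by gcongr
  have h13 : E / (4 * κ) * (x ⬝ᵥ x + y ⬝ᵥ y)
      = (E * (x ⬝ᵥ x) / (2 * κ) + E * (y ⬝ᵥ y) / (2 * κ)) / 2 := by field_simp; ring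
  rw [h13, hx, hy]
  have := mul_nonneg hκ.le hrx
  have := mul_nonneg hκ.le hry
  linarith

end QuadraticForms

/-! ### Contraction from a field of values condition -/

section FieldOfValues

open Matrix

variable {ι : Type} [Fintype ι]

variable [DecidableEq ι]

/-- A field of values bound, in the inner product of `P`: if the symmetric part of `A` lies between
`a P` and `c P` and the skew part is bounded by `e P`, then `w = P⁻¹ A r` satisfies
`‖w‖_P² ≤ (c + e² / a) ⟨r, A r⟩`. -/
theorem dotProduct_mulVec_le_of_fieldOfValues {A P : Matrix ι ι ℝ} (hP : P.PosDef) {a c e : ℝ}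
    (ha : 0 < a) (hc : 0 < c) (he : 0 < e)
    (hlow : ∀ x, a * (x ⬝ᵥ (P *ᵥ x)) ≤ x ⬝ᵥ (A *ᵥ x))
    (hup : ∀ x, x ⬝ᵥ (A *ᵥ x) ≤ c * (x ⬝ᵥ (P *ᵥ x)))
    (hskew : ∀ x y, x ⬝ᵥ (A *ᵥ y) - y ⬝ᵥ (A *ᵥ x) ≤ e * (x ⬝ᵥ (P *ᵥ x) + y ⬝ᵥ (P *ᵥ y)))
    {r w : ι → ℝ} (hw : P *ᵥ w = A *ᵥ r) :
    w ⬝ᵥ (P *ᵥ w) ≤ (c + e ^ 2 / a) * (r ⬝ᵥ (A *ᵥ r)) := by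
  set S : Matrix ι ι ℝ := A + Aᵀ with hS
  have hSxy : ∀ x y, x ⬝ᵥ (S *ᵥ y) = x ⬝ᵥ (A *ᵥ y) + y ⬝ᵥ (A *ᵥ x) := fun x y => by
    rw [hS, add_mulVec, dotProduct_add, dotProduct_transpose_mulVec]
  have hSpd : S.PosDef := by
    refine PosDef.of_dotProduct_mulVec_pos ?_ fun x hx => ?_
    · ext i j; simp [hS, add_comm]
    · have h1 : 0 < x ⬝ᵥ (P *ᵥ x) := by simpa using hP.dotProduct_mulVec_pos hx
      simp only [star_trivial]
      rw [hSxy]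
      have := hlow x
      nlinarith [mul_pos ha h1]
  -- The vector `v` represents the skew part in the inner product of `S`: `2 A w = S (w + v)` and `2
  -- Aᵀ w = S (w - v)`, with `v` orthogonal to `w` for `S`.
  obtain ⟨v, hv⟩ : ∃ v, S *ᵥ v = A *ᵥ w - Aᵀ *ᵥ w := by
    refine ⟨S⁻¹ *ᵥ (A *ᵥ w - Aᵀ *ᵥ w), ?_⟩
    rw [mulVec_mulVec, mul_nonsing_inv _ ((isUnit_iff_isUnit_det _).1 hSpd.isUnit), one_mulVec]
  have hyv : ∀ y, 2 * (y ⬝ᵥ (A *ᵥ w)) = y ⬝ᵥ (S *ᵥ w) + y ⬝ᵥ (S *ᵥ v) ∧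
      2 * (w ⬝ᵥ (A *ᵥ y)) = y ⬝ᵥ (S *ᵥ w) - y ⬝ᵥ (S *ᵥ v) := by
    intro y
    rw [hv, hSxy, dotProduct_sub, dotProduct_transpose_mulVec]
    constructor <;> ring
  have hcomm : ∀ x y, x ⬝ᵥ (S *ᵥ y) = y ⬝ᵥ (S *ᵥ x) := fun x y => by
    rw [hSxy, hSxy, add_comm]
  have hvv : v ⬝ᵥ (A *ᵥ v) ≤ e ^ 2 / a * (w ⬝ᵥ (P *ᵥ w)) := by
    -- The scaling `a / e` makes the `v`-term on the right equal `a ⟨v, P v⟩ ≤ ⟨v, A v⟩`, half of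
    -- the left side.
    have h1 := hskew ((a / e) • v) w
    have h2 := hyv v
    have h3 := hlow v
    rw [hSxy v v] at h2
    simp only [smul_dotProduct, mulVec_smul, dotProduct_smul, smul_eq_mul] at h1
    have h4 : v ⬝ᵥ (A *ᵥ w) - w ⬝ᵥ (A *ᵥ v) = 2 * (v ⬝ᵥ (A *ᵥ v)) := by linarith
    rw [← mul_sub, h4] at h1
    have h5 := mul_le_mul_of_nonneg_left h1 (div_pos he ha).le
    have e1 : e / a * (a / e * (2 * (v ⬝ᵥ (A *ᵥ v)))) = 2 * (v ⬝ᵥ (A *ᵥ v)) := by field_simp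
    have e2 : e / a * (e * (a / e * (a / e * (v ⬝ᵥ (P *ᵥ v))) + w ⬝ᵥ (P *ᵥ w)))
        = a * (v ⬝ᵥ (P *ᵥ v)) + e ^ 2 / a * (w ⬝ᵥ (P *ᵥ w)) := by field_simp
    rw [e1, e2] at h5
    linarith
  set C := c + e ^ 2 / a with hC
  have hCpos : 0 < C := by positivity
  have hg : w ⬝ᵥ (S *ᵥ w) + v ⬝ᵥ (S *ᵥ v) ≤ 2 * C * (w ⬝ᵥ (P *ᵥ w)) := by
    rw [hSxy, hSxy, hC]
    linarith [hup w]
  have hvw : v ⬝ᵥ (S *ᵥ w) = 0 := by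
    have := hyv w
    rw [hcomm v w]
    linarith
  have hwP : 2 * (w ⬝ᵥ (P *ᵥ w)) = r ⬝ᵥ (S *ᵥ w) - r ⬝ᵥ (S *ᵥ v) := by
    rw [hw]; exact (hyv r).2
  -- Cauchy–Schwarz in the inner product of `S` for `r` and `w - v`, in the form of one completed
  -- square.
  have hnn : 0 ≤ (w - v - C • r) ⬝ᵥ (S *ᵥ (w - v - C • r)) := by
    simpa using hSpd.posSemidef.dotProduct_mulVec_nonneg (w - v - C • r)
  simp only [mulVec_sub, mulVec_smul, dotProduct_sub, sub_dotProduct, smul_dotProduct,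
    dotProduct_smul, smul_eq_mul] at hnn
  rw [hcomm w v, hcomm w r, hcomm v r, hvw] at hnn
  have hrr := hSxy r r
  rw [hrr] at hnn
  have : C * (w ⬝ᵥ (P *ᵥ w)) ≤ C * (C * (r ⬝ᵥ (A *ᵥ r))) := by
    have h1 : C * (2 * (w ⬝ᵥ (P *ᵥ w))) = C * (r ⬝ᵥ (S *ᵥ w) - r ⬝ᵥ (S *ᵥ v)) := by rw [hwP]
    linarith
  exact le_of_mul_le_mul_left this hCpos

/-- One Richardson step with step length `(c + e² / a)⁻¹` contracts the residual in the norm of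
`P`. -/
theorem richardson_step {A P : Matrix ι ι ℝ} (hP : P.PosDef) {a c e : ℝ}
    (ha : 0 < a) (hc : 0 < c) (he : 0 < e)
    (hlow : ∀ x, a * (x ⬝ᵥ (P *ᵥ x)) ≤ x ⬝ᵥ (A *ᵥ x))
    (hup : ∀ x, x ⬝ᵥ (A *ᵥ x) ≤ c * (x ⬝ᵥ (P *ᵥ x)))
    (hskew : ∀ x y, x ⬝ᵥ (A *ᵥ y) - y ⬝ᵥ (A *ᵥ x) ≤ e * (x ⬝ᵥ (P *ᵥ x) + y ⬝ᵥ (P *ᵥ y)))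
    (r : ι → ℝ) :
    (r - (c + e ^ 2 / a)⁻¹ • ((P⁻¹ * A) *ᵥ r)) ⬝ᵥ
        (P *ᵥ (r - (c + e ^ 2 / a)⁻¹ • ((P⁻¹ * A) *ᵥ r))) ≤
      (1 - a / (c + e ^ 2 / a)) * (r ⬝ᵥ (P *ᵥ r)) := by
  set w := (P⁻¹ * A) *ᵥ r with hwdef
  have hw : P *ᵥ w = A *ᵥ r := by
    rw [hwdef, mulVec_mulVec, ← Matrix.mul_assoc,
      mul_nonsing_inv _ ((isUnit_iff_isUnit_det _).1 hP.isUnit), one_mul]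
  have h1 := dotProduct_mulVec_le_of_fieldOfValues hP ha hc he hlow hup hskew hw
  have hCpos : 0 < c + e ^ 2 / a := by positivity
  set C := c + e ^ 2 / a
  have hsymm : w ⬝ᵥ (P *ᵥ r) = r ⬝ᵥ (P *ᵥ w) := by
    have : Pᵀ = P := by simpa using hP.isHermitian.eq
    have h := dotProduct_transpose_mulVec P w r
    rwa [this] at h
  simp only [mulVec_sub, mulVec_smul, dotProduct_sub, sub_dotProduct, smul_dotProduct,
    dotProduct_smul, smul_eq_mul]
  rw [hsymm, hw, ← hw, hw]
  have h2 := hlow r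
  have h3 : C⁻¹ * (C⁻¹ * (w ⬝ᵥ (P *ᵥ w))) ≤ C⁻¹ * (r ⬝ᵥ (A *ᵥ r)) := by
    refine mul_le_mul_of_nonneg_left ?_ (by positivity)
    rw [inv_mul_le_iff₀ hCpos]; exact h1
  rw [hw] at h3
  have h4 : C⁻¹ * (a * (r ⬝ᵥ (P *ᵥ r))) ≤ C⁻¹ * (r ⬝ᵥ (A *ᵥ r)) :=
    mul_le_mul_of_nonneg_left h2 (by positivity)
  have h5 : (1 - a / C) * (r ⬝ᵥ (P *ᵥ r)) = r ⬝ᵥ (P *ᵥ r) - C⁻¹ * (a * (r ⬝ᵥ (P *ᵥ r))) := by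
    rw [div_eq_mul_inv]; ring
  rw [h5]
  linarith

end FieldOfValues

/-! ### GMRES iterates, Krylov spaces and the matrix square root -/

namespace RieszGMRES

open Matrix

variable {ι : Type} [Fintype ι]

theorem norm₂_eq_norm (v : ι → ℝ) : norm₂ v = ‖WithLp.toLp 2 v‖ := by
  simp [norm₂, EuclideanSpace.norm_eq]

theorem norm₂_eq_sqrt (v : ι → ℝ) : norm₂ v = √(v ⬝ᵥ v) := by
  simp [norm₂, dotProduct, pow_two]

variable [DecidableEq ι]

/-- GMRES iterates of a nonsingular system exist and are unique. -/
theorem existsUnique_isGMRESIterate {Z : Matrix ι ι ℝ} (hZ : IsUnit Z) (w u₀ : ι → ℝ) (k : ℕ) :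
    ∃! u, IsGMRESIterate Z w u₀ k u := by
  set r := w - Z *ᵥ u₀ with hr
  set K := krylov Z r k with hK
  let T : (ι → ℝ) →ₗ[ℝ] EuclideanSpace ℝ ι :=
    (WithLp.linearEquiv 2 ℝ (ι → ℝ)).symm.toLinearMap ∘ₗ Z.mulVecLin
  have hT : ∀ x, T x = WithLp.toLp 2 (Z *ᵥ x) := fun x => rfl
  have hTinj : Function.Injective T := by
    intro x y hxy
    have : Z *ᵥ x = Z *ᵥ y := by
      rw [hT, hT] at hxy
      exact WithLp.toLp_injective 2 hxy
    exact mulVec_injective_of_isUnit hZ this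
  have hres : ∀ u, norm₂ (w - Z *ᵥ u) = ‖WithLp.toLp 2 r - T (u - u₀)‖ := by
    intro u
    rw [norm₂_eq_norm, hT, ← WithLp.toLp_sub, hr, mulVec_sub]
    congr 2
    abel
  let W := K.map T
  -- Pythagoras around the orthogonal projection yields both minimality and, with injectivity of
  -- `T`, uniqueness.
  have hpy : ∀ q ∈ W, ‖WithLp.toLp 2 r - q‖ ^ 2
      = ‖WithLp.toLp 2 r - W.starProjection (WithLp.toLp 2 r)‖ ^ 2
        + ‖W.starProjection (WithLp.toLp 2 r) - q‖ ^ 2 := by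
    intro q hq
    have h0 := W.starProjection_inner_eq_zero (WithLp.toLp 2 r)
      (W.starProjection (WithLp.toLp 2 r) - q)
      (W.sub_mem (W.starProjection_apply_mem _) hq)
    have := norm_add_sq_eq_norm_sq_add_norm_sq_real h0
    rw [pow_two, pow_two, pow_two, ← this]
    congr 2 <;> abel_nf
  obtain ⟨x, hxK, hx⟩ := Submodule.mem_map.1 (W.starProjection_apply_mem (WithLp.toLp 2 r))
  refine ⟨u₀ + x, ⟨by simpa using hxK, fun v hv => ?_⟩, fun v hv => ?_⟩
  · rw [hres, hres, add_sub_cancel_left, hx]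
    refine le_of_sq_le_sq ?_ (norm_nonneg _)
    rw [hpy (T (v - u₀)) (Submodule.mem_map_of_mem hv)]
    nlinarith [sq_nonneg ‖W.starProjection (WithLp.toLp 2 r) - T (v - u₀)‖]
  · have h1 := hv.2 (u₀ + x) (by simpa using hxK)
    rw [hres, hres, add_sub_cancel_left, hx] at h1
    have h2 := hpy (T (v - u₀)) (Submodule.mem_map_of_mem hv.1)
    have h3 : ‖W.starProjection (WithLp.toLp 2 r) - T (v - u₀)‖ ^ 2 ≤ 0 := by
      have := pow_le_pow_left₀ (norm_nonneg _) h1 2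
      linarith
    have h4 : W.starProjection (WithLp.toLp 2 r) - T (v - u₀) = 0 := by
      rw [← norm_eq_zero]
      exact pow_eq_zero_iff (two_ne_zero) |>.1 (le_antisymm h3 (sq_nonneg _))
    rw [← hx, ← map_sub] at h4
    have h5 := hTinj (h4.trans (map_zero T).symm)
    rw [sub_eq_zero] at h5
    rw [h5]; abel

theorem mulVec_mem_krylov_succ (Z : Matrix ι ι ℝ) {x y : ι → ℝ} {k : ℕ} (h : y ∈ krylov Z x k) :
    Z *ᵥ y ∈ krylov Z x (k + 1) := by
  have : krylov Z x k ≤ (krylov Z x (k + 1)).comap Z.mulVecLin := by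
    refine Submodule.span_le.2 ?_
    rintro _ ⟨j, hj, rfl⟩
    refine Submodule.subset_span ⟨j + 1, by omega, ?_⟩
    simp [mulVec_mulVec, pow_succ']
  exact this h

theorem krylov_mono (Z : Matrix ι ι ℝ) (x : ι → ℝ) {k l : ℕ} (h : k ≤ l) :
    krylov Z x k ≤ krylov Z x l :=
  Submodule.span_mono fun _ ⟨j, hj, hy⟩ => ⟨j, hj.trans_le h, hy⟩

/-- The Richardson iterates lie in the Krylov spaces. -/
theorem exists_mem_krylov_residual_eq (Z : Matrix ι ι ℝ) (w u₀ : ι → ℝ) (ω : ℝ) (k : ℕ) :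
    ∃ v, v - u₀ ∈ krylov Z (w - Z *ᵥ u₀) k ∧
      w - Z *ᵥ v ∈ krylov Z (w - Z *ᵥ u₀) (k + 1) ∧
      w - Z *ᵥ v = (fun r => r - ω • (Z *ᵥ r))^[k] (w - Z *ᵥ u₀) := by
  induction k with
  | zero =>
    exact ⟨u₀, by simp, Submodule.subset_span ⟨0, by simp⟩, rfl⟩
  | succ k ih =>
    obtain ⟨v, h1, h2, h3⟩ := ih
    have h4 : w - Z *ᵥ (v + ω • (w - Z *ᵥ v)) = (w - Z *ᵥ v) - ω • (Z *ᵥ (w - Z *ᵥ v)) := by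
      rw [mulVec_add, mulVec_smul]; abel
    refine ⟨v + ω • (w - Z *ᵥ v), ?_, ?_, ?_⟩
    · rw [add_sub_right_comm]
      exact Submodule.add_mem _ (krylov_mono Z _ (Nat.le_succ k) h1) (Submodule.smul_mem _ _ h2)
    · rw [h4]
      exact Submodule.sub_mem _ (krylov_mono Z _ (Nat.le_succ _) h2)
        (Submodule.smul_mem _ _ (mulVec_mem_krylov_succ Z h2))
    · rw [h4, Function.iterate_succ_apply', ← h3]

theorem isSymm_matPow (B : Matrix ι ι ℝ) (z : ℝ) : (matPow B z)ᵀ = matPow B z := by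
  have : IsSelfAdjoint (matPow B z) := cfc_predicate _ _
  simpa [IsSelfAdjoint, star_eq_conjTranspose] using this

theorem matPow_neg_half_mul_self {B : Matrix ι ι ℝ} (hB : B.PosDef) :
    matPow B (-(1 / 2)) * matPow B (-(1 / 2)) = B⁻¹ := by
  have hsa : IsSelfAdjoint B := hB.isHermitian
  have hpos : ∀ x ∈ spectrum ℝ B, 0 < x := by
    intro x hx
    rw [hB.isHermitian.spectrum_real_eq_range_eigenvalues] at hx
    obtain ⟨i, rfl⟩ := hx
    exact hB.eigenvalues_pos i
  have hfin : (spectrum ℝ B).Finite := by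
    rw [hB.isHermitian.spectrum_real_eq_range_eigenvalues]
    exact Set.finite_range _
  -- On a finite spectrum every function is continuous, so the behaviour of the power at `0` is
  -- irrelevant.
  have hc : ∀ f : ℝ → ℝ, ContinuousOn f (spectrum ℝ B) := fun f => hfin.continuousOn f
  refine (inv_eq_left_inv ?_).symm
  rw [matPow, ← cfc_mul _ _ B (hc _) (hc _)]
  calc cfc (fun x : ℝ => x ^ (-(1 / 2) : ℝ) * x ^ (-(1 / 2) : ℝ)) B * B
      = cfc (fun x : ℝ => x ^ (-(1 / 2) : ℝ) * x ^ (-(1 / 2) : ℝ)) B * cfc (fun x : ℝ => x) B := by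
        rw [cfc_id' ℝ B hsa]
    _ = cfc (fun x : ℝ => x ^ (-(1 / 2) : ℝ) * x ^ (-(1 / 2) : ℝ) * x) B :=
        (cfc_mul _ _ B (hc _) (hc _)).symm
    _ = cfc (fun _ : ℝ => (1 : ℝ)) B := by
        refine cfc_congr fun x hx => ?_
        have := hpos x hx
        rw [← Real.rpow_add this]
        norm_num
        rw [Real.rpow_neg_one, inv_mul_cancel₀ this.ne']
    _ = 1 := cfc_const_one ℝ B hsa

/-- Both sides are the square root of `⟨y, P⁻¹ y⟩`, since the matrix power is symmetric and squares
to `P⁻¹`. -/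
theorem norm₂_matPow_mulVec {P : Matrix ι ι ℝ} (hP : P.PosDef) (y : ι → ℝ) :
    norm₂ (matPow P (-(1 / 2)) *ᵥ y) = √((P⁻¹ *ᵥ y) ⬝ᵥ (P *ᵥ (P⁻¹ *ᵥ y))) := by
  have h := dotProduct_transpose_mulVec (matPow P (-(1 / 2))) (matPow P (-(1 / 2)) *ᵥ y) y
  rw [isSymm_matPow] at h
  rw [norm₂_eq_sqrt, h, mulVec_mulVec, matPow_neg_half_mul_self hP, mulVec_mulVec _ P,
    mul_nonsing_inv _ ((isUnit_iff_isUnit_det _).1 hP.isUnit), one_mulVec,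
    dotProduct_comm (P⁻¹ *ᵥ y)]

/-- GMRES for `P⁻¹ A u = P⁻¹ b` under a field of values condition in the norm of `P`. -/
theorem gmres_residual_le {A P : Matrix ι ι ℝ} (hP : P.PosDef) {a c e : ℝ}
    (ha : 0 < a) (hc : 0 < c) (he : 0 < e) (hac : a ^ 2 ≤ a * c + e ^ 2)
    (hP1 : ∀ x, x ⬝ᵥ x ≤ x ⬝ᵥ (P *ᵥ x))
    (hlow : ∀ x, a * (x ⬝ᵥ (P *ᵥ x)) ≤ x ⬝ᵥ (A *ᵥ x))
    (hup : ∀ x, x ⬝ᵥ (A *ᵥ x) ≤ c * (x ⬝ᵥ (P *ᵥ x)))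
    (hskew : ∀ x y, x ⬝ᵥ (A *ᵥ y) - y ⬝ᵥ (A *ᵥ x) ≤ e * (x ⬝ᵥ (P *ᵥ x) + y ⬝ᵥ (P *ᵥ y)))
    (b u₀ : ι → ℝ) (k : ℕ) :
    (∃! u, IsGMRESIterate (P⁻¹ * A) (P⁻¹ *ᵥ b) u₀ k u) ∧
      ∀ u, IsGMRESIterate (P⁻¹ * A) (P⁻¹ *ᵥ b) u₀ k u →
        norm₂ (P⁻¹ *ᵥ b - (P⁻¹ * A) *ᵥ u) ≤ √(1 - a ^ 2 / (a * c + e ^ 2)) ^ k *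
          norm₂ (matPow P (-(1 / 2)) *ᵥ b - (matPow P (-(1 / 2)) * A) *ᵥ u₀) := by
  have hA : IsUnit A := by
    rw [← mulVec_injective_iff_isUnit, ← coe_mulVecLin, injective_iff_map_eq_zero]
    intro x hx
    by_contra h0
    have h1 : 0 < x ⬝ᵥ (P *ᵥ x) := by simpa using hP.dotProduct_mulVec_pos h0
    have h2 := hlow x
    rw [show A *ᵥ x = 0 from hx, dotProduct_zero] at h2
    nlinarith
  refine ⟨existsUnique_isGMRESIterate (hP.inv.isUnit.mul hA) _ _ _, fun u hu => ?_⟩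
  obtain ⟨v, hv, -, hres⟩ := exists_mem_krylov_residual_eq (P⁻¹ * A) (P⁻¹ *ᵥ b) u₀
    (c + e ^ 2 / a)⁻¹ k
  refine (hu.2 v hv).trans ?_
  have hq : a / (c + e ^ 2 / a) = a ^ 2 / (a * c + e ^ 2) := by field_simp
  have hq1 : 0 ≤ 1 - a ^ 2 / (a * c + e ^ 2) := by
    rw [sub_nonneg]; exact div_le_one_of_le₀ hac (by positivity)
  set q := 1 - a ^ 2 / (a * c + e ^ 2) with hqdef
  set r := P⁻¹ *ᵥ b - (P⁻¹ * A) *ᵥ u₀ with hr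
  have hit : ∀ j, ((fun r => r - (c + e ^ 2 / a)⁻¹ • ((P⁻¹ * A) *ᵥ r))^[j] r) ⬝ᵥ
      (P *ᵥ ((fun r => r - (c + e ^ 2 / a)⁻¹ • ((P⁻¹ * A) *ᵥ r))^[j] r)) ≤
      q ^ j * (r ⬝ᵥ (P *ᵥ r)) := by
    intro j
    induction j with
    | zero => simp
    | succ j ih =>
      rw [Function.iterate_succ_apply']
      refine (richardson_step hP ha hc he hlow hup hskew _).trans ?_
      rw [hq, ← hqdef, pow_succ' q, mul_assoc]
      exact mul_le_mul_of_nonneg_left ih hq1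
  have hr0 : matPow P (-(1 / 2)) *ᵥ b - (matPow P (-(1 / 2)) * A) *ᵥ u₀
      = matPow P (-(1 / 2)) *ᵥ (b - A *ᵥ u₀) := by rw [mulVec_sub, mulVec_mulVec]
  have hr1 : P⁻¹ *ᵥ (b - A *ᵥ u₀) = r := by rw [hr, mulVec_sub, mulVec_mulVec]
  rw [hr0, norm₂_matPow_mulVec hP, hr1, hres, norm₂_eq_sqrt]
  refine (Real.sqrt_le_sqrt ((hP1 _).trans (hit k))).trans_eq ?_
  rw [Real.sqrt_mul (by positivity)]
  congr 1
  rw [Real.sqrt_eq_iff_mul_self_eq (by positivity) (by positivity), ← mul_pow,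
    Real.mul_self_sqrt hq1]

end RieszGMRES

/-! ### Row sums of Toeplitz and Hankel matrices -/

theorem sum_fin_natAbs_sub {n : ℕ} (f : ℕ → ℝ) (j : Fin n) :
    ∑ t : Fin n, f ((j : ℤ) - (t : ℤ)).natAbs
      = f 0 + ∑ k ∈ Finset.range j, f (k + 1) + ∑ k ∈ Finset.range (n - 1 - j), f (k + 1) := by
  rw [Fin.sum_univ_eq_sum_range (fun t : ℕ => f ((j : ℤ) - (t : ℤ)).natAbs) n]
  obtain ⟨r, hr⟩ : ∃ r, n = (j + 1) + r := Nat.exists_eq_add_of_le j.2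
  rw [show n - 1 - (j : ℕ) = r by omega]
  rw [show Finset.range n = Finset.range (j + 1 + r) from congrArg _ hr, Finset.sum_range_add,
    ← Finset.sum_range_reflect]
  have h1 : ∑ k ∈ Finset.range (j + 1), f ((j : ℤ) - ((j + 1 - 1 - k : ℕ) : ℤ)).natAbs
      = ∑ k ∈ Finset.range (j + 1), f k := by
    refine Finset.sum_congr rfl fun k hk => ?_
    have := Finset.mem_range.1 hk
    congr 1
    omega
  have h2 : ∑ k ∈ Finset.range r, f ((j : ℤ) - ((j + 1 + k : ℕ) : ℤ)).natAbs
      = ∑ k ∈ Finset.range r, f (k + 1) := by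
    refine Finset.sum_congr rfl fun k hk => ?_
    congr 1
    omega
  rw [h1, h2, Finset.sum_range_succ']
  ring

namespace RieszGMRES

open Matrix

theorem isSymm_toeplitz (t : ℕ → ℝ) (n : ℕ) : (toeplitz t n).IsSymm := by
  ext i j
  simp only [toeplitz, transpose_apply, of_apply]
  congr 1
  omega

theorem isSymm_hankelPart (t : ℕ → ℝ) (n : ℕ) : (hankelPart t n).IsSymm := by
  ext i j
  simp only [hankelPart, transpose_apply, of_apply]
  rw [add_comm ((j : ℕ) + 1)]

section Toeplitz

variable {γ : ℝ} {w : ℕ → ℝ}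

theorem IsAdmissible.le_of_le (hw : IsAdmissible γ w) {k l : ℕ} (hk : 1 ≤ k) (h : k ≤ l) :
    w k ≤ w l := by
  induction l, h using Nat.le_induction with
  | base => exact le_rfl
  | succ l hl ih => exact ih.trans (hw.mono l (hk.trans hl))

theorem IsAdmissible.sum_range_nonneg (hw : IsAdmissible γ w) (n : ℕ) :
    0 ≤ w 0 + 2 * ∑ k ∈ Finset.range n, w (k + 1) := by
  have h := hw.sum_nonneg (n + 1) (by omega)
  rw [Finset.sum_Ico_eq_sum_range] at h
  simpa [add_comm] using h

theorem IsAdmissible.sum_range_anti (hw : IsAdmissible γ w) {k l : ℕ} (h : k ≤ l) :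
    ∑ i ∈ Finset.range l, w (i + 1) ≤ ∑ i ∈ Finset.range k, w (i + 1) := by
  induction l, h using Nat.le_induction with
  | base => exact le_rfl
  | succ l hl ih =>
    rw [Finset.sum_range_succ]
    linarith [hw.nonpos (l + 1) (by omega)]

theorem IsAdmissible.toeplitz_isSymmDominant (hw : IsAdmissible γ w) (n : ℕ) :
    (toeplitz w n).IsSymmDominant where
  symm := isSymm_toeplitz w n
  offDiag j k hjk := by
    refine hw.nonpos _ ?_
    have : (j : ℕ) ≠ k := fun h => hjk (Fin.ext h)
    omega
  rowSum j := by
    simp only [toeplitz, of_apply]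
    rw [sum_fin_natAbs_sub]
    have h1 := hw.sum_range_nonneg (n - 1)
    have h2 := hw.sum_range_anti (show (j : ℕ) ≤ n - 1 by omega)
    have h3 := hw.sum_range_anti (show n - 1 - (j : ℕ) ≤ n - 1 by omega)
    linarith

/-- The weights in a row of the Toeplitz matrix to the left of the diagonal and those in the left
part of the same row of the Hankel matrix are distinct. -/
theorem IsAdmissible.sum_range_le_add_hankel_left (hw : IsAdmissible γ w) {n : ℕ} (j : Fin n) :
    ∑ k ∈ Finset.range (n - 1), w (k + 1) ≤ ∑ k ∈ Finset.range j, w (k + 1)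
      + ∑ t : Fin n, if (j : ℕ) + t + 3 ≤ n then w (j + t + 2) else 0 := by
  rw [Fin.sum_univ_eq_sum_range (fun t : ℕ => if (j : ℕ) + t + 3 ≤ n then w (j + t + 2) else 0) n]
  rcases Nat.lt_or_ge (j + 1) n with hj | hj
  · obtain ⟨r, hr⟩ : ∃ r, n = (j + 2) + r := Nat.exists_eq_add_of_le hj
    rw [← Finset.sum_filter, show (Finset.range n).filter (fun t => (j : ℕ) + t + 3 ≤ n)
        = Finset.range r by ext t; simp; omega, show n - 1 = (j + 1) + r by omega,
      Finset.sum_range_add, Finset.sum_range_succ]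
    -- Row `j` uses the weights `1, …, j` and `j + 2, …, n - 1`; only index `j + 1` is skipped, and
    -- its weight is nonpositive.
    have h1 := hw.nonpos (j + 1) (by omega)
    have h2 : ∑ k ∈ Finset.range r, w (j + 1 + k + 1) = ∑ k ∈ Finset.range r, w (j + k + 2) :=
      Finset.sum_congr rfl fun k _ => by congr 1; omega
    rw [h2]
    linarith
  · rw [Finset.sum_eq_zero fun t _ => if_neg (by omega), add_zero, show n - 1 = (j : ℕ) by omega]

/-- The Hankel matrix is invariant under reversing both indices, which carries its lower right
triangle to the upper left one. -/
theorem hankelPart_row_sum (w : ℕ → ℝ) {n : ℕ} (j : Fin n) :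
    ∑ t, hankelPart w n j t = (∑ t : Fin n, if (j : ℕ) + t + 3 ≤ n then w (j + t + 2) else 0)
      + ∑ t : Fin n, if (j.rev : ℕ) + t + 3 ≤ n then w (j.rev + t + 2) else 0 := by
  rw [← Equiv.sum_comp Fin.revPerm
    (fun t : Fin n => if (j.rev : ℕ) + t + 3 ≤ n then w (j.rev + t + 2) else 0),
    ← Finset.sum_add_distrib]
  refine Finset.sum_congr rfl fun t _ => ?_
  simp only [hankelPart, of_apply, Fin.revPerm_apply, Fin.val_rev]
  have := j.2
  have := t.2
  split_ifs
  any_goals omega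
  · rw [add_zero]; congr 1; omega
  · rw [zero_add]; congr 1; omega
  · simp

theorem IsAdmissible.hankelPart_nonpos (hw : IsAdmissible γ w) {n : ℕ} (j t : Fin n) :
    hankelPart w n j t ≤ 0 := by
  simp only [hankelPart, of_apply]
  split_ifs
  · exact hw.nonpos _ (by omega)
  · exact hw.nonpos _ (by omega)
  · exact le_rfl

/-- The weights increase from index `1` on, and the Hankel index is at least `|j - t|`; where the
Hankel entry is `0`, the sign of the weights suffices. -/
theorem IsAdmissible.toeplitz_le_hankelPart (hw : IsAdmissible γ w) {n : ℕ} {j t : Fin n}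
    (h : j ≠ t) : toeplitz w n j t ≤ hankelPart w n j t := by
  have : (j : ℕ) ≠ t := fun h' => h (Fin.ext h')
  simp only [hankelPart, toeplitz, of_apply]
  split_ifs
  · exact hw.le_of_le (by omega) (by omega)
  · exact hw.le_of_le (by omega) (by omega)
  · exact hw.nonpos _ (by omega)

/-- Left of the diagonal, and again right of it, the entries of the Toeplitz and Hankel rows
together sum to at least the sum of all weights of index `1` to `n - 1`. Thus the rows of their sum
are nonnegative, and any `B` dominated as in `hdiag` and `hoff` is weakly diagonally dominant. -/
theorem IsAdmissible.sum_abs_le (hw : IsAdmissible γ w) {n : ℕ} {B : Matrix (Fin n) (Fin n) ℝ}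
    (hdiag : ∀ j, w 0 + hankelPart w n j j ≤ B j j)
    (hoff : ∀ j t, j ≠ t → |B j t| ≤ -toeplitz w n j t - hankelPart w n j t) (j : Fin n) :
    ∑ t, |B j t| ≤ 2 * B j j := by
  have h1 := hw.sum_range_le_add_hankel_left j
  have h2 := hw.sum_range_le_add_hankel_left j.rev
  have h3 := hw.sum_range_nonneg (n - 1)
  have hrow := hankelPart_row_sum w j
  have ht : ∑ t, toeplitz w n j t = w 0 + ∑ k ∈ Finset.range j, w (k + 1)
      + ∑ k ∈ Finset.range (j.rev : ℕ), w (k + 1) := by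
    simp only [toeplitz, of_apply]
    rw [sum_fin_natAbs_sub, Fin.val_rev, show n - 1 - (j : ℕ) = n - (j + 1) by omega]
  have hkey : 0 ≤ ∑ t, (toeplitz w n j t + hankelPart w n j t) := by
    rw [Finset.sum_add_distrib, hrow, ht]
    linarith
  have hjj : toeplitz w n j j = w 0 := by simp [toeplitz]
  rw [← Finset.add_sum_erase _ _ (Finset.mem_univ j), hjj] at hkey
  have hoff' : ∑ t ∈ Finset.univ.erase j, |B j t|
      ≤ -∑ t ∈ Finset.univ.erase j, (toeplitz w n j t + hankelPart w n j t) := by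
    rw [← Finset.sum_neg_distrib]
    refine Finset.sum_le_sum fun t ht => ?_
    have := hoff j t (Finset.ne_of_mem_erase ht).symm
    linarith
  have hnn : 0 ≤ ∑ t ∈ Finset.univ.erase j, |B j t| := Finset.sum_nonneg fun _ _ => abs_nonneg _
  have hd := hdiag j
  rw [← Finset.add_sum_erase _ _ (Finset.mem_univ j), abs_of_nonneg (by linarith)]
  linarith

theorem IsAdmissible.sum_abs_toeplitz_add_hankelPart_le (hw : IsAdmissible γ w) {n : ℕ}
    (j : Fin n) :
    ∑ t, |(toeplitz w n + hankelPart w n) j t| ≤ 2 * (toeplitz w n + hankelPart w n) j j := by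
  refine hw.sum_abs_le (fun j => by simp [toeplitz]) (fun j t hjt => ?_) j
  have h1 := (hw.toeplitz_isSymmDominant n).offDiag j t hjt
  have h2 := hw.hankelPart_nonpos j t
  rw [Matrix.add_apply, abs_of_nonpos (by linarith)]
  linarith

/-- Off the diagonal, with `T` the Toeplitz and `H` the Hankel entry, `T ≤ H ≤ 0` gives `|T - 3H| ≤
-T - H`; the factor `3` is the largest these inequalities permit. -/
theorem IsAdmissible.sum_abs_toeplitz_sub_hankelPart_le (hw : IsAdmissible γ w) {n : ℕ}
    (j : Fin n) :
    ∑ t, |(toeplitz w n - (3 : ℝ) • hankelPart w n) j t|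
      ≤ 2 * (toeplitz w n - (3 : ℝ) • hankelPart w n) j j := by
  refine hw.sum_abs_le (fun j => ?_) (fun j t hjt => ?_) j
  · have := hw.hankelPart_nonpos j j
    simp [toeplitz]
    linarith
  · have h1 := hw.toeplitz_le_hankelPart hjt
    have h2 := hw.hankelPart_nonpos j t
    simp only [Matrix.sub_apply, Matrix.smul_apply, smul_eq_mul]
    rw [abs_le]
    constructor <;> linarith

theorem IsAdmissible.abs_mul_le_decayNorm (hw : IsAdmissible γ w) (k : ℕ) :
    |w k| * (1 + (k : ℝ)) ^ (1 + γ) ≤ decayNorm γ w :=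
  le_csSup hw.decay ⟨k, rfl⟩

theorem IsAdmissible.decayNorm_nonneg (hw : IsAdmissible γ w) : 0 ≤ decayNorm γ w :=
  le_trans (by positivity) (hw.abs_mul_le_decayNorm 0)

/-- Decay of order `1 + γ` against the square leaves `k ^ (1 - γ)`, whose sum grows like `n ^ (2 -
γ)`; the factor `2` counts the two sides of the diagonal. -/
theorem IsAdmissible.sum_abs_toeplitz_mul_sq_le (hw : IsAdmissible γ w) (h1 : 1 < γ) (h2 : γ < 2)
    {n : ℕ} (j : Fin n) :
    ∑ t : Fin n, |toeplitz w n j t| * ((j : ℝ) - t) ^ 2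
      ≤ 2 * decayNorm γ w * ((n : ℝ) ^ (2 - γ) / (2 - γ)) := by
  have hN := hw.decayNorm_nonneg
  have hterm : ∀ k : ℕ, |w (k + 1)| * ((k + 1 : ℕ) : ℝ) ^ 2
      ≤ decayNorm γ w * ((k : ℝ) + 1) ^ (1 - γ) := by
    intro k
    have h := hw.abs_mul_le_decayNorm (k + 1)
    have hk : 0 < (k : ℝ) + 1 := by positivity
    have h3 : ((k + 1 : ℕ) : ℝ) ^ 2 = ((k : ℝ) + 1) ^ (1 + γ) * ((k : ℝ) + 1) ^ (1 - γ) := by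
      rw [← Real.rpow_add hk, ← Real.rpow_natCast]
      push_cast
      norm_num
    rw [h3, ← mul_assoc]
    refine mul_le_mul_of_nonneg_right (le_trans ?_ h) (by positivity)
    refine mul_le_mul_of_nonneg_left (Real.rpow_le_rpow hk.le ?_ (by linarith)) (abs_nonneg _)
    push_cast
    linarith
  have hpart : ∀ m ≤ n, ∑ k ∈ Finset.range m, |w (k + 1)| * ((k + 1 : ℕ) : ℝ) ^ 2
      ≤ decayNorm γ w * ((n : ℝ) ^ (2 - γ) / (2 - γ)) := by
    intro m hm
    refine (Finset.sum_le_sum fun k _ => hterm k).trans ?_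
    rw [← Finset.mul_sum]
    refine mul_le_mul_of_nonneg_left ((sum_rpow_le h1 h2 m).trans ?_) hN
    have : 0 < 2 - γ := by linarith
    gcongr
  have hsum := sum_fin_natAbs_sub (fun k => |w k| * (k : ℝ) ^ 2) j
  have h4 := hpart j j.2.le
  have h5 := hpart (n - 1 - j) (by omega)
  refine le_trans (le_of_eq ?_) (show |w 0| * ((0 : ℕ) : ℝ) ^ 2
      + ∑ k ∈ Finset.range j, |w (k + 1)| * ((k + 1 : ℕ) : ℝ) ^ 2
      + ∑ k ∈ Finset.range (n - 1 - j), |w (k + 1)| * ((k + 1 : ℕ) : ℝ) ^ 2 ≤ _ by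
    norm_num at h4 h5 ⊢; linarith)
  rw [← hsum]
  refine Finset.sum_congr rfl fun t _ => ?_
  simp only [toeplitz, of_apply]
  rw [Nat.cast_natAbs, Int.cast_abs, sq_abs]
  push_cast
  rfl

end Toeplitz

/-! ### Kronecker products acting in one direction -/

section ModeKron

variable {m : ℕ} {M : Fin m → ℕ}

theorem sum_ite_agree (i : Fin m) (K : MIdx M) (g : MIdx M → ℝ) :
    ∑ K' : MIdx M, (if ∀ j, j ≠ i → K j = K' j then g K' else 0)
      = ∑ t, g (Function.update K i t) := by
  rw [← Finset.sum_filter]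
  have hup : ∀ K' : MIdx M, (∀ j, j ≠ i → K j = K' j) → Function.update K i (K' i) = K' := by
    intro K' h
    ext j
    by_cases hj : j = i
    · subst hj; simp
    · simp [hj, h j hj]
  refine Finset.sum_nbij' (fun K' => K' i) (fun t => Function.update K i t) ?_ ?_ ?_ ?_ ?_
  · simp
  · intro t _
    simp only [Finset.mem_filter, Finset.mem_univ, true_and]
    intro j hj
    simp [hj]
  · intro K' hK'
    exact hup K' (Finset.mem_filter.1 hK').2
  · simp
  · intro K' hK'
    rw [hup K' (Finset.mem_filter.1 hK').2]

theorem modeKron_apply (i : Fin m) (B : Matrix (Fin (M i)) (Fin (M i)) ℝ) (K K' : MIdx M) :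
    modeKron i B K K' = if ∀ j, j ≠ i → K j = K' j then B (K i) (K' i) else 0 := rfl

theorem sum_abs_modeKron_mul (i : Fin m) (B : Matrix (Fin (M i)) (Fin (M i)) ℝ) (K : MIdx M)
    (g : MIdx M → ℝ) :
    ∑ K', |modeKron i B K K'| * g K' = ∑ t, |B (K i) t| * g (Function.update K i t) := by
  have h := sum_ite_agree i K (fun K' => |B (K i) (K' i)| * g K')
  simp only [Function.update_self] at h
  rw [← h]
  refine Finset.sum_congr rfl fun K' _ => ?_
  rw [modeKron_apply]
  split_ifs <;> simp

theorem isSymm_modeKron (i : Fin m) {B : Matrix (Fin (M i)) (Fin (M i)) ℝ} (hB : B.IsSymm) :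
    (modeKron i B).IsSymm := by
  ext K K'
  rw [transpose_apply, modeKron_apply, modeKron_apply, hB.apply]
  simp only [eq_comm]

theorem modeKron_sub (i : Fin m) (B C : Matrix (Fin (M i)) (Fin (M i)) ℝ) :
    modeKron i (B - C) = modeKron i B - modeKron i C := by
  ext K K'
  simp only [modeKron_apply, Matrix.sub_apply]
  split_ifs <;> simp

theorem modeKron_add (i : Fin m) (B C : Matrix (Fin (M i)) (Fin (M i)) ℝ) :
    modeKron i (B + C) = modeKron i B + modeKron i C := by
  ext K K'
  simp only [modeKron_apply, Matrix.add_apply]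
  split_ifs <;> simp

theorem isSymmDominant_modeKron (i : Fin m) {B : Matrix (Fin (M i)) (Fin (M i)) ℝ}
    (hB : B.IsSymmDominant) : (modeKron i B).IsSymmDominant where
  symm := isSymm_modeKron i hB.symm
  offDiag K K' hne := by
    rw [modeKron_apply]
    split_ifs with h
    · refine hB.offDiag _ _ fun hi => hne (funext fun j => ?_)
      by_cases hj : j = i
      · rw [hj, hi]
      · exact h j hj
    · exact le_rfl
  rowSum K := by
    have h := sum_ite_agree i K (fun K' => B (K i) (K' i))
    simp only [Function.update_self] at h
    simp only [modeKron_apply]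
    rw [h]
    exact hB.rowSum _

theorem dotProduct_modeKron_nonneg (i : Fin m) {B : Matrix (Fin (M i)) (Fin (M i)) ℝ}
    (hB : B.IsSymm) (h : ∀ j, ∑ t, |B j t| ≤ 2 * B j j) (x : MIdx M → ℝ) :
    0 ≤ x ⬝ᵥ (modeKron i B *ᵥ x) := by
  refine dotProduct_mulVec_nonneg_of_sum_abs_le (isSymm_modeKron i hB) (fun K => ?_) x
  have h1 := sum_abs_modeKron_mul i B K (fun _ => 1)
  simp only [mul_one] at h1
  rw [h1, modeKron_apply, if_pos fun _ _ => rfl]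
  exact h (K i)

/-- The τ-approximation is spectrally equivalent to the Toeplitz matrix. -/
theorem IsAdmissible.tauMatrix_equiv {γ : ℝ} {w : ℕ → ℝ} (hw : IsAdmissible γ w) (i : Fin m)
    (x : MIdx M → ℝ) :
    x ⬝ᵥ (modeKron i (tauMatrix w (M i)) *ᵥ x) / 2 ≤ x ⬝ᵥ (modeKron i (toeplitz w (M i)) *ᵥ x) ∧
      x ⬝ᵥ (modeKron i (toeplitz w (M i)) *ᵥ x)
        ≤ 3 / 2 * (x ⬝ᵥ (modeKron i (tauMatrix w (M i)) *ᵥ x)) := by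
  have h1 := dotProduct_modeKron_nonneg i
    ((isSymm_toeplitz w (M i)).add (isSymm_hankelPart w (M i)))
    hw.sum_abs_toeplitz_add_hankelPart_le x
  have h2 := dotProduct_modeKron_nonneg i
    ((isSymm_toeplitz w (M i)).sub ((isSymm_hankelPart w (M i)).smul 3))
    hw.sum_abs_toeplitz_sub_hankelPart_le x
  rw [show (3 : ℝ) • hankelPart w (M i) = hankelPart w (M i) + hankelPart w (M i) + hankelPart w (M i) by
    ext; simp; ring] at h2
  simp only [modeKron_sub, modeKron_add, add_mulVec, sub_mulVec, dotProduct_add, dotProduct_sub]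
    at h1 h2
  simp only [tauMatrix, modeKron_sub, sub_mulVec, dotProduct_sub]
  constructor <;> linarith

end ModeKron

end RieszGMRES

/-! ### The grid, the Lipschitz error and the constants -/

namespace RieszGMRES

open Matrix

theorem mul_le_of_ofReal_le_div {t a b : ℝ} (ht : 0 ≤ t) (ha : 0 ≤ a)
    (h : ENNReal.ofReal t ≤ ENNReal.ofReal a / ENNReal.ofReal b) : t * b ≤ a := by
  have h1 := ENNReal.mul_le_of_le_div h
  rwa [← ENNReal.ofReal_mul ht, ENNReal.ofReal_le_ofReal_iff ha] at h1

namespace Data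

variable {m : ℕ} (D : Data m)

theorem abs_sub_le_lipSeminorm {D : Data m} {i : Fin m} {f : (Fin m → ℝ) → ℝ} (hf : D.MemLip i f)
    {x y : Fin m → ℝ} (hx : x ∈ D.Ω) (hy : y ∈ D.Ω) (hxy : ∀ j, j ≠ i → x j = y j) :
    |f x - f y| ≤ D.lipSeminorm i f * |x i - y i| := by
  rcases eq_or_ne x y with rfl | hne
  · simp
  have hi : x i ≠ y i := fun h => hne (funext fun j => by
    by_cases hj : j = i
    · rw [hj, h]
    · exact hxy j hj)
  have hnorm : √(∑ k, |x k - y k| ^ 2) = |x i - y i| := by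
    rw [Finset.sum_eq_single i (fun j _ hj => by simp [hxy j hj]) (by simp),
      Real.sqrt_sq (abs_nonneg _)]
  have h : |f x - f y| / |x i - y i| ≤ D.lipSeminorm i f := by
    refine le_csSup hf ⟨x, hx, x, ⟨hx i, fun _ _ => rfl⟩, y,
      ⟨hy i, fun j hj => (hxy j hj).symm⟩, hne, by rw [hnorm]⟩
  rwa [div_le_iff₀ (abs_pos.2 (sub_ne_zero.2 hi))] at h

/-- The common factor of the summands of `b₁`, `b₂` and `b₃`. -/
noncomputable def q (i : Fin m) : ℝ := decayNorm (D.α i) (D.s i) * D.lipSeminorm i (D.d i) ^ 2 *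
  (D.r i - D.l i) ^ (2 - D.α i) / (2 - D.α i)

/-- The values of `d_i` at the grid points. -/
noncomputable def gridValue (M : Fin m → ℕ) (i : Fin m) (K : MIdx M) : ℝ := D.d i (D.gridPoint M K)

theorem b₁_eq : D.b₁ = ∑ i, D.q i / (4 * ((1 - √2 / 2) * D.dlo i)) := by
  simp only [b₁, q, div_div]
  exact Finset.sum_congr rfl fun i _ => by congr 1; ring

theorem b₂_eq : D.b₂ = ∑ i, D.q i / (4 * ((√2 - 1) * D.dhi i)) := by
  simp only [b₂, q, div_div]
  exact Finset.sum_congr rfl fun i _ => by congr 1; ring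

theorem b₃_eq : D.b₃ = ∑ i, D.q i * (D.dhi i ^ 2 / D.dlo i ^ 2) := by
  simp only [b₃, q]
  refine Finset.sum_congr rfl fun i _ => ?_
  rw [div_mul_div_comm, mul_comm (2 - D.α i)]
  congr 1
  ring

section Assumptions

variable {D}
variable (hbox : ∀ i, D.l i < D.r i)
include hbox

theorem h_pos (M : Fin m → ℕ) (i : Fin m) : 0 < D.h M i :=
  div_pos (sub_pos.2 (hbox i)) (by positivity)

theorem gridPoint_mem (M : Fin m → ℕ) (K : MIdx M) : D.gridPoint M K ∈ D.Ω := by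
  intro i
  have h1 := h_pos hbox M i
  have h2 : D.r i = D.l i + ((M i : ℝ) + 1) * D.h M i := by
    rw [h]; field_simp; ring
  have h3 : ((K i : ℕ) : ℝ) + 1 ≤ M i := by exact_mod_cast (K i).2
  simp only [gridPoint, Set.mem_Ioo]
  constructor
  · have : 0 < (((K i : ℕ) : ℝ) + 1) * D.h M i := by positivity
    linarith
  · rw [h2]
    nlinarith

theorem dlo_le_dhi (hd : ∀ i, ∀ x ∈ D.Ω, D.dlo i ≤ D.d i x ∧ D.d i x ≤ D.dhi i) (i : Fin m) :
    D.dlo i ≤ D.dhi i := by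
  have hx : (fun j => (D.l j + D.r j) / 2) ∈ D.Ω := fun j => by
    have := hbox j
    constructor <;> linarith
  exact (hd i _ hx).1.trans (hd i _ hx).2

variable (hα : ∀ i, D.α i ∈ Set.Ioo (1 : ℝ) 2)
include hα
variable (hs : ∀ i, IsRieszWeight (D.α i) (D.s i))
include hs

theorem q_nonneg (i : Fin m) : 0 ≤ D.q i := by
  have h1 := ((hs i).isAdmissible (hα i).1 (hα i).2).decayNorm_nonneg
  have h2 := sub_pos.2 (hbox i)
  have h3 : 0 < 2 - D.α i := sub_pos.2 (hα i).2
  rw [q]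
  positivity

/-- The commutator of the coefficient with the discretised operator is small. -/
theorem sum_abs_modeKron_mul_sq_le (hLip : ∀ i, D.MemLip i (D.d i)) (M : Fin m → ℕ) {Δt : ℝ}
    (hΔt : 0 < Δt) (i : Fin m) (K : MIdx M) :
    ∑ K', |modeKron i (toeplitz (D.s i) (M i)) K K'|
        * (D.gridValue M i K - D.gridValue M i K') ^ 2 ≤ 2 * Δt * D.q i / D.η M Δt i := by
  have hw := (hs i).isAdmissible (hα i).1 (hα i).2
  have hN := hw.decayNorm_nonneg
  have hh := h_pos hbox M i
  have hp : 0 < 2 - D.α i := sub_pos.2 (hα i).2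
  have hη : 0 < D.η M Δt i := by rw [η]; positivity
  have hrl := sub_pos.2 (hbox i)
  rw [sum_abs_modeKron_mul i _ K (fun K' => (D.gridValue M i K - D.gridValue M i K') ^ 2)]
  have hstep : ∀ t : Fin (M i), (D.gridValue M i K - D.gridValue M i (Function.update K i t)) ^ 2
      ≤ (D.lipSeminorm i (D.d i) * D.h M i) ^ 2 * (((K i : ℕ) : ℝ) - (t : ℕ)) ^ 2 := by
    intro t
    have h1 := abs_sub_le_lipSeminorm (hLip i) (gridPoint_mem hbox M K)
      (gridPoint_mem hbox M (Function.update K i t)) (fun j hj => by simp [gridPoint, hj])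
    have h2 : D.gridPoint M K i - D.gridPoint M (Function.update K i t) i
        = D.h M i * (((K i : ℕ) : ℝ) - (t : ℕ)) := by
      simp only [gridPoint, Function.update_self]; ring
    rw [h2, abs_mul, abs_of_pos hh, ← mul_assoc] at h1
    have h3 := pow_le_pow_left₀ (abs_nonneg _) h1 2
    rwa [sq_abs, mul_pow _ |_|, sq_abs] at h3
  calc ∑ t, |toeplitz (D.s i) (M i) (K i) t|
        * (D.gridValue M i K - D.gridValue M i (Function.update K i t)) ^ 2
      ≤ ∑ t : Fin (M i), |toeplitz (D.s i) (M i) (K i) t| *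
        ((D.lipSeminorm i (D.d i) * D.h M i) ^ 2 * (((K i : ℕ) : ℝ) - (t : ℕ)) ^ 2) :=
        Finset.sum_le_sum fun t _ => mul_le_mul_of_nonneg_left (hstep t) (abs_nonneg _)
    _ = (D.lipSeminorm i (D.d i) * D.h M i) ^ 2 *
        ∑ t : Fin (M i), |toeplitz (D.s i) (M i) (K i) t| * (((K i : ℕ) : ℝ) - (t : ℕ)) ^ 2 := by
        rw [Finset.mul_sum]
        exact Finset.sum_congr rfl fun t _ => by ring
    _ ≤ (D.lipSeminorm i (D.d i) * D.h M i) ^ 2 * (2 * decayNorm (D.α i) (D.s i) *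
        ((M i : ℝ) ^ (2 - D.α i) / (2 - D.α i))) :=
        mul_le_mul_of_nonneg_left (hw.sum_abs_toeplitz_mul_sq_le (hα i).1 (hα i).2 (K i))
          (sq_nonneg _)
    _ ≤ 2 * Δt * D.q i / D.η M Δt i := by
        rw [le_div_iff₀ hη]
        -- The powers of the step size cancel: `h² η = Δt h ^ (2 - α)`, and `h M ≤ r - l`. This is
        -- why the error does not depend on the mesh.
        have h1 : D.h M i ^ 2 * (M i : ℝ) ^ (2 - D.α i) * D.η M Δt i
            ≤ Δt * (D.r i - D.l i) ^ (2 - D.α i) := by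
          have h2 : D.h M i ^ 2 = D.h M i ^ (2 - D.α i) * D.h M i ^ D.α i := by
            rw [← Real.rpow_add hh, ← Real.rpow_natCast]; norm_num
          have h3 : D.h M i * M i ≤ D.r i - D.l i := by
            have : D.r i - D.l i = D.h M i * ((M i : ℝ) + 1) := by rw [h]; field_simp
            rw [this]; nlinarith
          have h4 : D.h M i ^ D.α i ≠ 0 := by positivity
          calc D.h M i ^ 2 * (M i : ℝ) ^ (2 - D.α i) * D.η M Δt i
              = Δt * (D.h M i * M i) ^ (2 - D.α i) := by
                rw [h2, η, Real.mul_rpow hh.le (by positivity)]; field_simp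
            _ ≤ _ := by gcongr
        have h5 : 0 ≤ 2 * decayNorm (D.α i) (D.s i) * D.lipSeminorm i (D.d i) ^ 2
            / (2 - D.α i) := by positivity
        have h6 := mul_le_mul_of_nonneg_left h1 h5
        calc _ = _ := by ring
          _ ≤ _ := h6
          _ = _ := by rw [q]; ring

end Assumptions

section QuadraticForms

variable {D} (M : Fin m → ℕ) (Δt : ℝ)

theorem dotProduct_A_mulVec (x y : MIdx M → ℝ) :
    x ⬝ᵥ (D.A M Δt *ᵥ y) = x ⬝ᵥ y + ∑ i, D.η M Δt i * (x ⬝ᵥ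
      ((diagonal (D.gridValue M i) * modeKron i (toeplitz (D.s i) (M i))) *ᵥ y)) := by
  simp only [A, add_mulVec, one_mulVec, dotProduct_add, sum_mulVec, dotProduct_sum, smul_mulVec,
    dotProduct_smul, smul_eq_mul]
  rfl

theorem dotProduct_P_mulVec (x : MIdx M → ℝ) :
    x ⬝ᵥ (D.P M Δt *ᵥ x) = x ⬝ᵥ x + ∑ i, D.η M Δt i * (D.dbar i * (x ⬝ᵥ
      (modeKron i (tauMatrix (D.s i) (M i)) *ᵥ x))) := by
  simp only [P, add_mulVec, one_mulVec, dotProduct_add, sum_mulVec, dotProduct_sum, smul_mulVec,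
    dotProduct_smul, smul_eq_mul]

theorem isSymm_P : (D.P M Δt).IsSymm := by
  refine isSymm_one.add ?_
  rw [IsSymm, transpose_sum]
  refine Finset.sum_congr rfl fun i _ => ?_
  exact ((isSymm_modeKron i ((isSymm_toeplitz _ _).sub (isSymm_hankelPart _ _))).smul _).smul _

end QuadraticForms

section Constants

variable {D}

theorem c₁_le (i : Fin m) : D.c₁ ≤ √(D.dlo i / (2 * D.dhi i)) :=
  ciInf_le (Set.finite_range _).bddBelow i

theorem le_c₂ (i : Fin m) : √(2 * D.dhi i / D.dlo i) ≤ D.c₂ :=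
  le_ciSup (f := fun i => √(2 * D.dhi i / D.dlo i)) (Set.finite_range _).bddAbove i

theorem le_c₃ (i : Fin m) : (D.dhi i ^ 2 + D.dlo i ^ 2 + 1) / (2 * D.dbar i) ≤ D.c₃ :=
  le_ciSup (f := fun i => (D.dhi i ^ 2 + D.dlo i ^ 2 + 1) / (2 * D.dbar i))
    (Set.finite_range _).bddAbove i

variable (hlo : ∀ i, 0 < D.dlo i) (hle : ∀ i, D.dlo i ≤ D.dhi i)
include hlo hle

theorem dbar_pos (i : Fin m) : 0 < D.dbar i :=
  Real.sqrt_pos.2 (mul_pos ((hlo i).trans_le (hle i)) (hlo i))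

theorem le_two_c₃_mul_dbar (i : Fin m) :
    D.dhi i ^ 2 + D.dlo i ^ 2 + 1 ≤ 2 * (D.c₃ * D.dbar i) := by
  have h1 := dbar_pos hlo hle i
  have h2 := (div_le_iff₀ (by positivity)).1 (le_c₃ (D := D) i)
  linarith

/-- The `i`-th candidate in the minimum times `d̄_i` is exactly `ď_i / √2`. The room left below
`ď_i` serves as the Young parameter. -/
theorem c₁_mul_dbar_le (i : Fin m) : D.c₁ * D.dbar i ≤ √2 / 2 * D.dlo i := by
  have h0 := hlo i
  have h1 := h0.trans_le (hle i)
  refine (mul_le_mul_of_nonneg_right (c₁_le i) (Real.sqrt_nonneg _)).trans_eq ?_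
  rw [← Real.sqrt_mul (by positivity), Real.sqrt_eq_iff_mul_self_eq (by positivity)
    (by positivity)]
  have : √2 * √2 = 2 := Real.mul_self_sqrt (by norm_num)
  field_simp
  linear_combination -this

theorem sqrt_two_mul_dhi_le (i : Fin m) : √2 * D.dhi i ≤ D.c₂ * D.dbar i := by
  have h0 := hlo i
  have h1 := h0.trans_le (hle i)
  refine le_trans (le_of_eq ?_) (mul_le_mul_of_nonneg_right (le_c₂ i) (Real.sqrt_nonneg _))
  symm
  rw [dbar, ← Real.sqrt_mul (by positivity), Real.sqrt_eq_iff_mul_self_eq (by positivity)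
    (by positivity)]
  have : √2 * √2 = 2 := Real.mul_self_sqrt (by norm_num)
  field_simp
  linear_combination -this

variable [Nonempty (Fin m)]

theorem c₁_pos : 0 < D.c₁ := by
  obtain ⟨i, hi⟩ := exists_eq_ciInf_of_finite (f := fun i => √(D.dlo i / (2 * D.dhi i)))
  rw [c₁, ← hi]
  have := hlo i
  have := this.trans_le (hle i)
  positivity

theorem c₁_lt_one : D.c₁ < 1 := by
  obtain ⟨i⟩ := ‹Nonempty (Fin m)›
  have := hlo i
  have := hle i
  refine (c₁_le i).trans_lt ((Real.sqrt_lt' one_pos).2 ?_)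
  rw [div_lt_iff₀ (by linarith)]
  linarith

theorem sqrt_two_le_c₂ : √2 ≤ D.c₂ := by
  obtain ⟨i⟩ := ‹Nonempty (Fin m)›
  refine (Real.sqrt_le_sqrt ?_).trans (le_c₂ i)
  rw [le_div_iff₀ (hlo i)]
  linarith [hle i]

theorem one_lt_c₂ : 1 < D.c₂ :=
  lt_of_lt_of_le (by rw [Real.lt_sqrt] <;> norm_num) (sqrt_two_le_c₂ hlo hle)

theorem c₃_pos : 0 < D.c₃ := by
  obtain ⟨i⟩ := ‹Nonempty (Fin m)›
  have := dbar_pos hlo hle i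
  exact lt_of_lt_of_le (by positivity) (le_c₃ i)

theorem c₁_sq_lt : D.c₁ ^ 2 < 3 * D.c₁ * D.c₂ + 9 * D.c₃ ^ 2 := by
  have h1 := c₁_pos hlo hle
  have h2 := (c₁_lt_one hlo hle).trans (one_lt_c₂ hlo hle)
  have h3 := c₃_pos hlo hle
  nlinarith [mul_pos h1 (h1.trans h2)]

theorem cStar_pos : 0 < D.cStar := by
  have h1 := sub_pos.2 (c₁_lt_one hlo hle)
  have h2 := sub_pos.2 (one_lt_c₂ hlo hle)
  have h3 := c₃_pos hlo hle
  refine lt_min ?_ (lt_min ?_ ?_) <;>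
  · refine ENNReal.div_pos ?_ ENNReal.ofReal_ne_top
    exact (ENNReal.ofReal_pos.2 (by assumption)).ne'

theorem θ_pos : 0 < D.θ := by
  have h := c₁_sq_lt hlo hle
  have := c₁_pos hlo hle
  refine Real.sqrt_pos.2 (sub_pos.2 ((div_lt_one ?_).2 h))
  exact (sq_nonneg _).trans_lt h

theorem θ_lt_one : D.θ < 1 := by
  have h := c₁_sq_lt hlo hle
  have h1 := c₁_pos hlo hle
  refine (Real.sqrt_lt' one_pos).2 ?_
  have := div_pos (pow_pos h1 2) ((sq_nonneg _).trans_lt h)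
  linarith

end Constants

/-! ### Comparison of the coefficient matrix with the preconditioner -/

section Bounds

variable {D}
  (hbox : ∀ i, D.l i < D.r i)
  (hα : ∀ i, D.α i ∈ Set.Ioo (1 : ℝ) 2)
  (hs : ∀ i, IsRieszWeight (D.α i) (D.s i))
  (hlo : ∀ i, 0 < D.dlo i)
  (hd : ∀ i, ∀ x ∈ D.Ω, D.dlo i ≤ D.d i x ∧ D.d i x ≤ D.dhi i)
  (hLip : ∀ i, D.MemLip i (D.d i))
  (M : Fin m → ℕ) {Δt : ℝ} (hΔt : 0 < Δt)

section
include hbox hΔt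

theorem η_pos (i : Fin m) : 0 < D.η M Δt i := by
  have := h_pos hbox M i
  rw [η]
  positivity

end

include hα hs in
theorem dotProduct_modeKron_tauMatrix_nonneg_and_toeplitz_nonneg (i : Fin m) (x : MIdx M → ℝ) :
    0 ≤ x ⬝ᵥ (modeKron i (tauMatrix (D.s i) (M i)) *ᵥ x) ∧
    0 ≤ x ⬝ᵥ (modeKron i (toeplitz (D.s i) (M i)) *ᵥ x) := by
  obtain ⟨h1, h2⟩ := ((hs i).isAdmissible (hα i).1 (hα i).2).tauMatrix_equiv (M := M) i x
  constructor <;> linarith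

include hbox hα hs hlo hd hΔt

theorem dotProduct_self_le_P (x : MIdx M → ℝ) : x ⬝ᵥ x ≤ x ⬝ᵥ (D.P M Δt *ᵥ x) := by
  rw [dotProduct_P_mulVec, le_add_iff_nonneg_right]
  exact Finset.sum_nonneg fun i _ => mul_nonneg (η_pos hbox M hΔt i).le
    (mul_nonneg (dbar_pos hlo (dlo_le_dhi hbox hd) i).le
      (dotProduct_modeKron_tauMatrix_nonneg_and_toeplitz_nonneg hα hs M i x).1)

theorem posDef_P : (D.P M Δt).PosDef := by
  refine PosDef.of_dotProduct_mulVec_pos ?_ fun x hx => ?_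
  · rw [IsHermitian, conjTranspose_eq_transpose_of_trivial]
    exact isSymm_P M Δt
  · rw [star_trivial]
    refine lt_of_lt_of_le ?_ (dotProduct_self_le_P hbox hα hs hlo hd M hΔt x)
    simpa using dotProduct_star_self_pos_iff.2 hx

/-- The preconditioner and its untruncated Toeplitz analogue are spectrally equivalent. -/
theorem toeplitz_form_bounds (x : MIdx M → ℝ) :
    (x ⬝ᵥ (D.P M Δt *ᵥ x)) / 2 ≤ x ⬝ᵥ x + ∑ i, D.η M Δt i * (D.dbar i * (x ⬝ᵥ
        (modeKron i (toeplitz (D.s i) (M i)) *ᵥ x))) ∧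
      x ⬝ᵥ x + ∑ i, D.η M Δt i * (D.dbar i * (x ⬝ᵥ
        (modeKron i (toeplitz (D.s i) (M i)) *ᵥ x))) ≤ 3 / 2 * (x ⬝ᵥ (D.P M Δt *ᵥ x)) := by
  have hxx : 0 ≤ x ⬝ᵥ x := by simpa using dotProduct_star_self_nonneg x
  have hc : ∀ i, 0 ≤ D.η M Δt i * D.dbar i := fun i =>
    mul_nonneg (η_pos hbox M hΔt i).le (dbar_pos hlo (dlo_le_dhi hbox hd) i).le
  have he := fun i => ((hs i).isAdmissible (hα i).1 (hα i).2).tauMatrix_equiv (M := M) i x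
  rw [dotProduct_P_mulVec]
  constructor
  · have h1 := Finset.sum_le_sum fun i (_ : i ∈ Finset.univ) =>
      mul_le_mul_of_nonneg_left (he i).1 (hc i)
    simp only [← mul_div_assoc, ← Finset.sum_div, mul_assoc] at h1
    linarith
  · have h1 := Finset.sum_le_sum fun i (_ : i ∈ Finset.univ) =>
      mul_le_mul_of_nonneg_left (he i).2 (hc i)
    simp only [mul_left_comm _ (3 / 2 : ℝ), ← Finset.mul_sum, mul_assoc] at h1
    linarith

include hLip
variable [Nonempty (Fin m)]

/-- The coefficient is frozen at `(√2/2) ď_i`, leaving the gap `(1 - √2/2) ď_i` that appears in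
`b₁`. The total error `Δt b₁` is taken from the identity, which keeps the share `c₁`. -/
theorem le_dotProduct_A (hb : Δt * D.b₁ ≤ 1 - D.c₁) (x : MIdx M → ℝ) :
    D.c₁ / 2 * (x ⬝ᵥ (D.P M Δt *ᵥ x)) ≤ x ⬝ᵥ (D.A M Δt *ᵥ x) := by
  have hle := dlo_le_dhi hbox hd
  have hxx : 0 ≤ x ⬝ᵥ x := by simpa using dotProduct_star_self_nonneg x
  have hs2 : √2 / 2 < 1 := by
    have : √2 < 2 := by rw [Real.sqrt_lt'] <;> norm_num
    linarith
  have hterm : ∀ i, D.c₁ * (D.η M Δt i * (D.dbar i * (x ⬝ᵥ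
        (modeKron i (toeplitz (D.s i) (M i)) *ᵥ x))))
      - Δt * (D.q i / (4 * ((1 - √2 / 2) * D.dlo i))) * (x ⬝ᵥ x) ≤ D.η M Δt i * (x ⬝ᵥ
      ((diagonal (D.gridValue M i) * modeKron i (toeplitz (D.s i) (M i))) *ᵥ x)) := by
    intro i
    have hη := η_pos hbox M hΔt i
    have hκ : 0 < (1 - √2 / 2) * D.dlo i := mul_pos (by linarith) (hlo i)
    have hB := isSymmDominant_modeKron i
      (((hs i).isAdmissible (hα i).1 (hα i).2).toeplitz_isSymmDominant (M i))
    have h1 := hB.le_dotProduct_diagonal_mul (d := D.gridValue M i) (c := √2 / 2 * D.dlo i) hκ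
      (fun K => by linarith [(hd i _ (gridPoint_mem hbox M K)).1,
        show D.gridValue M i K = D.d i (D.gridPoint M K) from rfl])
      (sum_abs_modeKron_mul_sq_le hbox hα hs hLip M hΔt i) x
    have h2 := mul_le_mul_of_nonneg_left h1 hη.le
    have h3 := mul_le_mul_of_nonneg_right (c₁_mul_dbar_le hlo hle i)
      (mul_nonneg hη.le (dotProduct_modeKron_tauMatrix_nonneg_and_toeplitz_nonneg hα hs M i x).2)
    have h4 : D.η M Δt i * (2 * Δt * D.q i / D.η M Δt i / (8 * ((1 - √2 / 2) * D.dlo i)) * (x ⬝ᵥ x))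
        = Δt * (D.q i / (4 * ((1 - √2 / 2) * D.dlo i))) * (x ⬝ᵥ x) := by
      field_simp; ring
    rw [mul_sub, h4] at h2
    linarith
  have h1 := Finset.sum_le_sum fun i (_ : i ∈ Finset.univ) => hterm i
  rw [Finset.sum_sub_distrib, ← Finset.mul_sum, ← Finset.sum_mul, ← Finset.mul_sum, ← b₁_eq] at h1
  have h2 := mul_le_mul_of_nonneg_right hb hxx
  have h3 := mul_le_mul_of_nonneg_left (toeplitz_form_bounds hbox hα hs hlo hd M hΔt x).1
    (c₁_pos hlo hle).le
  rw [dotProduct_A_mulVec]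
  linarith

theorem dotProduct_A_le (hb : Δt * D.b₂ ≤ D.c₂ - 1) (x : MIdx M → ℝ) :
    x ⬝ᵥ (D.A M Δt *ᵥ x) ≤ 3 * D.c₂ / 2 * (x ⬝ᵥ (D.P M Δt *ᵥ x)) := by
  have hle := dlo_le_dhi hbox hd
  have hxx : 0 ≤ x ⬝ᵥ x := by simpa using dotProduct_star_self_nonneg x
  have hs2 : 1 < √2 := by rw [Real.lt_sqrt] <;> norm_num
  have hterm : ∀ i, D.η M Δt i * (x ⬝ᵥ
      ((diagonal (D.gridValue M i) * modeKron i (toeplitz (D.s i) (M i))) *ᵥ x)) ≤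
      D.c₂ * (D.η M Δt i * (D.dbar i * (x ⬝ᵥ
        (modeKron i (toeplitz (D.s i) (M i)) *ᵥ x))))
      + Δt * (D.q i / (4 * ((√2 - 1) * D.dhi i))) * (x ⬝ᵥ x) := by
    intro i
    have hη := η_pos hbox M hΔt i
    have hhi := (hlo i).trans_le (hle i)
    have hκ : 0 < (√2 - 1) * D.dhi i := mul_pos (by linarith) hhi
    have hB := isSymmDominant_modeKron i
      (((hs i).isAdmissible (hα i).1 (hα i).2).toeplitz_isSymmDominant (M i))
    have h1 := hB.dotProduct_diagonal_mul_le (d := D.gridValue M i) (c := √2 * D.dhi i) hκ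
      (fun K => by linarith [(hd i _ (gridPoint_mem hbox M K)).2,
        show D.gridValue M i K = D.d i (D.gridPoint M K) from rfl])
      (sum_abs_modeKron_mul_sq_le hbox hα hs hLip M hΔt i) x
    have h2 := mul_le_mul_of_nonneg_left h1 hη.le
    have h3 := mul_le_mul_of_nonneg_right (sqrt_two_mul_dhi_le hlo hle i)
      (mul_nonneg hη.le (dotProduct_modeKron_tauMatrix_nonneg_and_toeplitz_nonneg hα hs M i x).2)
    have h4 : D.η M Δt i * (2 * Δt * D.q i / D.η M Δt i / (8 * ((√2 - 1) * D.dhi i)) * (x ⬝ᵥ x))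
        = Δt * (D.q i / (4 * ((√2 - 1) * D.dhi i))) * (x ⬝ᵥ x) := by
      field_simp; ring
    rw [mul_add, h4] at h2
    linarith
  have h1 := Finset.sum_le_sum fun i (_ : i ∈ Finset.univ) => hterm i
  rw [Finset.sum_add_distrib, ← Finset.mul_sum, ← Finset.sum_mul, ← Finset.mul_sum, ← b₂_eq] at h1
  have h2 := mul_le_mul_of_nonneg_right hb hxx
  have h3 := mul_le_mul_of_nonneg_left (toeplitz_form_bounds hbox hα hs hlo hd M hΔt x).2
    (one_pos.trans (one_lt_c₂ hlo hle)).le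
  rw [dotProduct_A_mulVec]
  linarith

theorem dotProduct_A_skew_le (hb : Δt * D.b₃ ≤ D.c₃) (x y : MIdx M → ℝ) :
    x ⬝ᵥ (D.A M Δt *ᵥ y) - y ⬝ᵥ (D.A M Δt *ᵥ x) ≤
      3 * D.c₃ / 2 * (x ⬝ᵥ (D.P M Δt *ᵥ x) + y ⬝ᵥ (D.P M Δt *ᵥ y)) := by
  have hle := dlo_le_dhi hbox hd
  have hxx : 0 ≤ x ⬝ᵥ x := by simpa using dotProduct_star_self_nonneg x
  have hyy : 0 ≤ y ⬝ᵥ y := by simpa using dotProduct_star_self_nonneg y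
  have hterm : ∀ i, D.η M Δt i * (x ⬝ᵥ
      ((diagonal (D.gridValue M i) * modeKron i (toeplitz (D.s i) (M i))) *ᵥ y))
      - D.η M Δt i * (y ⬝ᵥ
      ((diagonal (D.gridValue M i) * modeKron i (toeplitz (D.s i) (M i))) *ᵥ x)) ≤
      D.c₃ * (D.η M Δt i * (D.dbar i * (x ⬝ᵥ
        (modeKron i (toeplitz (D.s i) (M i)) *ᵥ x))))
      + D.c₃ * (D.η M Δt i * (D.dbar i * (y ⬝ᵥ
        (modeKron i (toeplitz (D.s i) (M i)) *ᵥ y))))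
      + Δt * (D.q i * (D.dhi i ^ 2 / D.dlo i ^ 2)) * (x ⬝ᵥ x + y ⬝ᵥ y) := by
    intro i
    have hη := η_pos hbox M hΔt i
    have h0 := hlo i
    -- This Young parameter satisfies `κ ≤ 2 c₃ d̄_i`, which is how `c₃` arises.
    set κ := D.dhi i ^ 2 + D.dlo i ^ 2 + 1 with hκdef
    have hκ : 1 ≤ κ := by nlinarith [sq_nonneg (D.dhi i), sq_nonneg (D.dlo i)]
    have hB := isSymmDominant_modeKron i
      (((hs i).isAdmissible (hα i).1 (hα i).2).toeplitz_isSymmDominant (M i))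
    have h1 := hB.dotProduct_diagonal_mul_skew_le (d := D.gridValue M i) (κ := κ) (by linarith)
      (sum_abs_modeKron_mul_sq_le hbox hα hs hLip M hΔt i) x y
    have h2 := mul_le_mul_of_nonneg_left h1 hη.le
    have h3 := mul_le_mul_of_nonneg_right (le_two_c₃_mul_dbar hlo hle i)
      (mul_nonneg hη.le (add_nonneg
        (dotProduct_modeKron_tauMatrix_nonneg_and_toeplitz_nonneg hα hs M i x).2
        (dotProduct_modeKron_tauMatrix_nonneg_and_toeplitz_nonneg hα hs M i y).2))
    rw [← hκdef] at h3
    have h4 : D.η M Δt i * (2 * Δt * D.q i / D.η M Δt i / (4 * κ) * (x ⬝ᵥ x + y ⬝ᵥ y))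
        = Δt * (D.q i * (1 / (2 * κ))) * (x ⬝ᵥ x + y ⬝ᵥ y) := by
      field_simp; ring
    -- The factor in `b₃` is generous: the left side is at most `1`, the right side at least `1`.
    have h5 : 1 / (2 * κ) ≤ D.dhi i ^ 2 / D.dlo i ^ 2 := by
      have h6 : 1 / (2 * κ) ≤ 1 := by rw [div_le_one (by linarith)]; linarith
      refine h6.trans ((one_le_div (by positivity)).2 ?_)
      exact pow_le_pow_left₀ h0.le (hle i) 2
    have h7 : Δt * (D.q i * (1 / (2 * κ))) * (x ⬝ᵥ x + y ⬝ᵥ y)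
        ≤ Δt * (D.q i * (D.dhi i ^ 2 / D.dlo i ^ 2)) * (x ⬝ᵥ x + y ⬝ᵥ y) := by
      have := q_nonneg hbox hα hs i
      gcongr
    rw [mul_add, h4] at h2
    linarith
  have h1 := Finset.sum_le_sum fun i (_ : i ∈ Finset.univ) => hterm i
  rw [Finset.sum_sub_distrib, Finset.sum_add_distrib, Finset.sum_add_distrib, ← Finset.mul_sum,
    ← Finset.mul_sum, ← Finset.sum_mul, ← Finset.mul_sum, ← b₃_eq] at h1
  have h2 := mul_le_mul_of_nonneg_right hb (add_nonneg hxx hyy)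
  have hc := (c₃_pos hlo hle).le
  have h3 := mul_le_mul_of_nonneg_left (toeplitz_form_bounds hbox hα hs hlo hd M hΔt x).2 hc
  have h4 := mul_le_mul_of_nonneg_left (toeplitz_form_bounds hbox hα hs hlo hd M hΔt y).2 hc
  rw [dotProduct_A_mulVec, dotProduct_A_mulVec, dotProduct_comm y x]
  linarith

end Bounds

end Data

end RieszGMRES


theorem theorem4p1 {m : ℕ} (hm : 1 ≤ m) (D : RieszGMRES.Data m)
    (hbox : ∀ i, D.l i < D.r i)
    (hα : ∀ i, D.α i ∈ Set.Ioo (1 : ℝ) 2)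
    (hs : ∀ i, RieszGMRES.IsRieszWeight (D.α i) (D.s i))
    (hlo : ∀ i, 0 < D.dlo i)
    (hd : ∀ i, ∀ x ∈ D.Ω, D.dlo i ≤ D.d i x ∧ D.d i x ≤ D.dhi i)
    (hLip : ∀ i, D.MemLip i (D.d i)) :
    (0 < D.c₁ ∧ D.c₁ < 1) ∧ √2 ≤ D.c₂ ∧ 0 < D.cStar ∧ (0 < D.θ ∧ D.θ < 1) ∧
    ∀ M : Fin m → ℕ, (∀ i, 1 ≤ M i) →
    ∀ Δt : ℝ, 0 < Δt → ENNReal.ofReal Δt ≤ D.cStar →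
      (D.P M Δt).PosDef ∧
      ∀ (b u₀ : RieszGMRES.MIdx M → ℝ) (k : ℕ), 1 ≤ k →
        (∃! u, RieszGMRES.IsGMRESIterate ((D.P M Δt)⁻¹ * D.A M Δt)
          (Matrix.mulVec (D.P M Δt)⁻¹ b) u₀ k u) ∧
        ∀ u, RieszGMRES.IsGMRESIterate ((D.P M Δt)⁻¹ * D.A M Δt)
            (Matrix.mulVec (D.P M Δt)⁻¹ b) u₀ k u →
          RieszGMRES.norm₂ (Matrix.mulVec (D.P M Δt)⁻¹ b
              - Matrix.mulVec ((D.P M Δt)⁻¹ * D.A M Δt) u) ≤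
            D.θ ^ k * RieszGMRES.norm₂
              (Matrix.mulVec (RieszGMRES.matPow (D.P M Δt) (-(1 / 2))) b
                - Matrix.mulVec (RieszGMRES.matPow (D.P M Δt) (-(1 / 2)) * D.A M Δt) u₀) := by
  have : Nonempty (Fin m) := ⟨⟨0, hm⟩⟩
  have hle := RieszGMRES.Data.dlo_le_dhi hbox hd
  have h1 := RieszGMRES.Data.c₁_pos hlo hle
  have h1' := RieszGMRES.Data.c₁_lt_one hlo hle
  have h2 := RieszGMRES.Data.one_lt_c₂ hlo hle
  have h3 := RieszGMRES.Data.c₃_pos hlo hle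
  refine ⟨⟨h1, h1'⟩, RieszGMRES.Data.sqrt_two_le_c₂ hlo hle, RieszGMRES.Data.cStar_pos hlo hle,
    ⟨RieszGMRES.Data.θ_pos hlo hle, RieszGMRES.Data.θ_lt_one hlo hle⟩,
    fun M _ Δt hΔt hc => ?_⟩
  obtain ⟨hb1, hb2, hb3⟩ := (le_min_iff.1 hc).imp_right le_min_iff.1
  have hb1 := RieszGMRES.mul_le_of_ofReal_le_div hΔt.le (by linarith) hb1
  have hb2 := RieszGMRES.mul_le_of_ofReal_le_div hΔt.le (by linarith) hb2
  have hb3 := RieszGMRES.mul_le_of_ofReal_le_div hΔt.le h3.le hb3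
  have hP := RieszGMRES.Data.posDef_P hbox hα hs hlo hd M hΔt
  refine ⟨hP, fun b u₀ k _ => ?_⟩
  -- The common factor `1/4` cancels for `a = c₁/2`, `c = 3c₂/2`, `e = 3c₃/2`.
  have hθ : D.θ = √(1 - (D.c₁ / 2) ^ 2 / (D.c₁ / 2 * (3 * D.c₂ / 2) + (3 * D.c₃ / 2) ^ 2)) := by
    rw [RieszGMRES.Data.θ, show D.c₁ / 2 * (3 * D.c₂ / 2) + (3 * D.c₃ / 2) ^ 2
      = (3 * D.c₁ * D.c₂ + 9 * D.c₃ ^ 2) / 4 by ring, div_pow, show (2 : ℝ) ^ 2 = 4 by norm_num,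
      div_div_div_cancel_right₀ (by norm_num)]
  rw [hθ]
  exact RieszGMRES.gmres_residual_le hP (by linarith) (by linarith) (by linarith)
    (by nlinarith [RieszGMRES.Data.c₁_sq_lt hlo hle])
    (RieszGMRES.Data.dotProduct_self_le_P hbox hα hs hlo hd M hΔt)
    (RieszGMRES.Data.le_dotProduct_A hbox hα hs hlo hd hLip M hΔt hb1)
    (RieszGMRES.Data.dotProduct_A_le hbox hα hs hlo hd hLip M hΔt hb2)
    (RieszGMRES.Data.dotProduct_A_skew_le hbox hα hs hlo hd hLip M hΔt hb3) b u₀ k
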